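/- Work over $\mathbb{C}$, let $R=\mathbb{C}[x_0,\dots,x_n]$, and let $X\subset\mathbb{P}^n$ be an irreducible projective variety that is non-degenerate (contained in no hyperplane) and whose homogeneous ideal $I_X\subset R$ is generated by quadrics. Let $$I_X\leftarrow F_0\otimes R(-2)\leftarrow F_1\otimes R(-3)\leftarrow\cdots\leftarrow F_r\otimes R(-r-2)$$ be the linear part of the minimal graded free resolution of $I_X$; the elements of $F_i$ are called $i$-th linear syzygies. Let $p\ge 1$ and $f\in F_p$. Let $G\subset F_{p-1}$ be the smallest subspace such that the differential maps $f$ into $G\otimes R(-p-1)$; its dimension is called the rank of $f$. The inclusion $G\subset F_{p-1}$ extends uniquely to a map from the Koszul complex $$\textstyle\bigwedge^{p}G\otimes R(-2)\leftarrow\cdots\leftarrow\bigwedge^{1}G\otimes R(-p-1)\leftarrow f\otimes R(-p-2)$$ to the complex $F_0\otimes R(-2)\leftarrow\cdots\leftarrow F_p\otimes R(-p-2)$. Let $I_f\subset I_X$ be the ideal generated by the image of $\bigwedge^pG\to F_0\to I_X$, and let the syzygy scheme $\mathrm{Syz}(f)=V(I_f)\subset\mathbb{P}^n$ be the closed subscheme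 defined by $I_f$. If $f$ has rank $p+2$, then $\mathrm{Syz}(f)$ is a (reduced) rational normal scroll, possibly a cone, of degree $p+2$ and codimension $p+1$ in $\mathbb{P}^n$; more precisely, $I_f$ is the full homogeneous ideal of such a scroll. Here a rational normal scroll in $\mathbb{P}^n$ is obtained as follows: choose integers $a_1,\dots,a_d\ge 0$, not all zero, with $\sum_i(a_i+1)=n+1$, a basis $(e_{i,j})_{1\le i\le d,\,0\le j\le a_i}$ of $\mathbb{C}^{n+1}$, and take the union over all $(s:t)\in\mathbb{P}^1$ of the linear spans of the $d$ points $\sum_{j} s^{a_i-j}t^j e_{i,j}$, $i=1,\dots,d$. The degree is that given by the leading coefficient of the Hilbert polynomial of $R/I_f$, and the codimension is the height of $I_f$. -/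

import Mathlib

open scoped LinearAlgebra.Projectivization

noncomputable section

namespace SyzScheme

/-- The homogeneous coordinate ring `R = ℂ[x₀, …, xₙ]` of `ℙⁿ`. -/
abbrev CoordRing (n : ℕ) : Type := MvPolynomial (Fin (n + 1)) ℂ

/-- Complex projective `n`-space, as the set of lines in `ℂⁿ⁺¹`. -/
abbrev ProjSpace (n : ℕ) : Type := ℙ ℂ (Fin (n + 1) → ℂ)

/-! ### Projective varieties -/

/-- `F` vanishes at the point `x` of `ℙⁿ`, i.e. on every vector of the line `x`. For homogeneous `F`
this is the vanishing of `F` at a representative; in general it says that all homogeneous components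
of `F` vanish at `x`. -/
def VanishesAt {n : ℕ} (F : CoordRing n) (x : ProjSpace n) : Prop :=
  ∀ v ∈ x.submodule, MvPolynomial.eval v F = 0

/-- The common zero set in `ℙⁿ` of a set of polynomials. -/
def zeroLocus {n : ℕ} (J : Set (CoordRing n)) : Set (ProjSpace n) :=
  {x | ∀ F ∈ J, VanishesAt F x}

/-- The homogeneous ideal `I_X` of a subset `X ⊆ ℙⁿ`. -/
def vanishingIdeal {n : ℕ} (X : Set (ProjSpace n)) : Ideal (CoordRing n) where
  carrier := {F | ∀ x ∈ X, VanishesAt F x}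
  add_mem' := by
    intro F F' hF hF' x hx v hv
    rw [map_add, hF x hx v hv, hF' x hx v hv, add_zero]
  zero_mem' := by
    intro x _ v _
    exact map_zero _
  smul_mem' := by
    intro c F hF x hx v hv
    rw [smul_eq_mul, map_mul, hF x hx v hv, mul_zero]

/-- Zariski closed subsets of `ℙⁿ`. -/
def IsAlgebraicSet {n : ℕ} (X : Set (ProjSpace n)) : Prop :=
  ∃ J : Set (CoordRing n), X = zeroLocus J

/-- Irreducible projective varieties in `ℙⁿ`: nonempty Zariski closed subsets that are irreducible in
the Zariski topology. -/
structure IsIrreducibleVariety {n : ℕ} (X : Set (ProjSpace n)) : Prop where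
  closed : IsAlgebraicSet X
  nonempty : X.Nonempty
  irreducible : ∀ Y Z : Set (ProjSpace n), IsAlgebraicSet Y → IsAlgebraicSet Z →
    X ⊆ Y ∪ Z → X ⊆ Y ∨ X ⊆ Z

/-- `X` is non-degenerate: no proper linear subspace of `ℙⁿ` contains `X`. -/
def IsNondegenerate {n : ℕ} (X : Set (ProjSpace n)) : Prop :=
  ∀ H : Submodule ℂ (Fin (n + 1) → ℂ), (∀ x ∈ X, x.submodule ≤ H) → H = ⊤

/-- The ideal `I` is generated by homogeneous polynomials of degree two. -/
def GeneratedByQuadrics {n : ℕ} (I : Ideal (CoordRing n)) : Prop :=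
  ∃ S : Set (CoordRing n), (∀ F ∈ S, F.IsHomogeneous 2) ∧ I = Ideal.span S

/-! ### Minimal free resolutions and linear syzygies -/

/-- A minimal graded free resolution `I ← P₀ ← P₁ ← ⋯` of the ideal `I` by finitely generated graded
free modules. The `i`-th module is `Pᵢ = ⨁ₖ R(-deg i k)`, with `k` running over `Fin (rk i)`. -/
structure MinimalResolution {n : ℕ} (I : Ideal (CoordRing n)) where
  /-- the rank of `Pᵢ` -/
  rk : ℕ → ℕ
  /-- the degrees of the basis vectors of `Pᵢ` -/
  deg : ∀ i, Fin (rk i) → ℕ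
  /-- the augmentation `P₀ → I ⊆ R` -/
  ε : (Fin (rk 0) → CoordRing n) →ₗ[CoordRing n] CoordRing n
  /-- the differential `Pᵢ₊₁ → Pᵢ` -/
  d : ∀ i, (Fin (rk (i + 1)) → CoordRing n) →ₗ[CoordRing n] (Fin (rk i) → CoordRing n)
  range_ε : LinearMap.range ε = I
  exact_zero : Function.Exact (d 0) ε
  exact_succ : ∀ i, Function.Exact (d (i + 1)) (d i)
  /-- the augmentation preserves degrees -/
  ε_homogeneous : ∀ k, (ε (Pi.single k 1)).IsHomogeneous (deg 0 k)
  /-- the differentials preserve degrees: the `(l, k)` matrix entry is zero or homogeneous of degree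
  `deg (i + 1) k - deg i l` -/
  d_homogeneous : ∀ i k l, ∀ m ∈ (d i (Pi.single k 1) l).support,
    m.degree + deg i l = deg (i + 1) k
  /-- minimality: the matrix entries lie in the irrelevant maximal ideal -/
  minimal : ∀ i k l, MvPolynomial.constantCoeff (d i (Pi.single k 1) l) = 0

namespace MinimalResolution

variable {n : ℕ} {I : Ideal (CoordRing n)} (P : MinimalResolution I)

/-- The `i`-th module `Pᵢ` of the resolution. -/
abbrev Mod (i : ℕ) : Type := Fin (P.rk i) → CoordRing n

/-- The space `Fᵢ` of `i`-th linear syzygies: the `ℂ`-span in `Pᵢ` of the basis vectors of degree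
`i + 2`. Thus `Fᵢ ⊗ R(-i-2) ⊆ Pᵢ` is the `i`-th module of the linear strand. -/
def linSyz (i : ℕ) : Submodule ℂ (P.Mod i) :=
  Submodule.span ℂ {e | ∃ k, P.deg i k = i + 2 ∧ e = Pi.single k 1}

/-- The space `G` of `q`-th syzygies involved in a `(q + 1)`-st linear syzygy `f`: the smallest
subspace `G ⊆ F_q` such that the differential maps `f` into `G ⊗ R ⊆ F_q ⊗ R`. -/
def involved {q : ℕ} (f : P.Mod (q + 1)) : Submodule ℂ (P.Mod q) :=
  sInf {W | W ≤ P.linSyz q ∧ P.d q f ∈ Submodule.span (CoordRing n) (W : Set (P.Mod q))}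

/-- The rank of a linear syzygy `f`: the dimension of the space of syzygies involved in `f`. -/
def rank {q : ℕ} (f : P.Mod (q + 1)) : ℕ := Module.finrank ℂ (P.involved f)

/-- A map from the Koszul complex of `G` to the linear strand that extends `G ⊗ R ← f ⊗ R`:
`⋀^(q+1) G ⊗ R(-2) ← ⋯ ← ⋀¹ G ⊗ R(-q-2) ← f ⊗ R(-q-3)` is mapped to
`F₀ ⊗ R(-2) ← ⋯ ← F_q ⊗ R(-q-2) ← F_(q+1) ⊗ R(-q-3)`.
Writing `d f = ∑ᵥ xᵥ gᵥ` with `gᵥ ∈ G`, the Koszul differential is `w ↦ ∑ᵥ xᵥ ⊗ (gᵥ ∧ w)`.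
The vertical maps are determined by `f` (the differential is injective on `Fᵢ₊₁`, and `∑ᵥ xᵥ hᵥ = 0`
with constant vectors `hᵥ` forces `hᵥ = 0`), so there is only one such map of complexes. Only the
values of `φ i` on `⋀^(q+1-i) G` are constrained or used. -/
structure KoszulLift {q : ℕ} (f : P.Mod (q + 1)) where
  /-- the coefficients of `d f` with respect to the variables -/
  g : Fin (n + 1) → P.involved f
  d_f : P.d q f = ∑ v, (MvPolynomial.X v : CoordRing n) • (g v : P.Mod q)
  /-- the vertical maps, `φ i` being used on `⋀^(q+1-i) G` -/
  φ : ∀ i, ExteriorAlgebra ℂ (P.involved f) →ₗ[ℂ] P.Mod i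
  φ_mem : ∀ i j, i + j = q + 1 → ∀ w ∈ ⋀[ℂ]^j (P.involved f), φ i w ∈ P.linSyz i
  /-- `φ_(q+1)` sends the generator of `⋀⁰ G = ℂ` to `f` -/
  φ_one : φ (q + 1) 1 = f
  /-- `φ_q` is the inclusion `G ⊆ F_q` -/
  φ_ι : ∀ x : P.involved f, φ q (ExteriorAlgebra.ι ℂ x) = x
  /-- the squares commute -/
  comm : ∀ i j, i + j = q → ∀ w ∈ ⋀[ℂ]^j (P.involved f),
    P.d i (φ (i + 1) w) =
      ∑ v, (MvPolynomial.X v : CoordRing n) • φ i (ExteriorAlgebra.ι ℂ (g v) * w)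

/-- The syzygy ideal `I_f`: the ideal generated by the image of `⋀^(q+1) G → F₀ → I` under the map
of complexes above. The zero scheme of this homogeneous ideal is the syzygy scheme `Syz(f)`. -/
def syzygyIdeal {q : ℕ} (f : P.Mod (q + 1)) : Ideal (CoordRing n) :=
  Ideal.span {F | ∃ L : P.KoszulLift f, ∃ w ∈ ⋀[ℂ]^(q + 1) (P.involved f), F = P.ε (L.φ 0 w)}

end MinimalResolution

/-! ### Rational normal scrolls and degree -/

/-- The Hilbert function `m ↦ dim_ℂ (R/J)_m` of a homogeneous ideal `J`. -/
def hilbertFunction {n : ℕ} (J : Ideal (CoordRing n)) (m : ℕ) : ℕ :=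
  Module.finrank ℂ (MvPolynomial.homogeneousSubmodule (Fin (n + 1)) ℂ m ⧸
    (J.restrictScalars ℂ).comap (MvPolynomial.homogeneousSubmodule (Fin (n + 1)) ℂ m).subtype)

/-- The closed subscheme of `ℙⁿ` defined by the homogeneous ideal `J` has degree `e`: the leading
coefficient of its Hilbert polynomial is `e / r!`, where `r` is the degree of this polynomial. -/
def HasDegree {n : ℕ} (J : Ideal (CoordRing n)) (e : ℕ) : Prop :=
  ∃ H : Polynomial ℚ, (∀ᶠ m : ℕ in Filter.atTop, (hilbertFunction J m : ℚ) = H.eval (m : ℚ)) ∧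
    (H.natDegree.factorial : ℚ) * H.leadingCoeff = e

/-- Rational normal scrolls in `ℙⁿ` (cones included). Choose complementary linear subspaces
`ℙ^(a i)`, `i = 1, …, d`, that span `ℙⁿ` and in each of them a rational normal curve of degree `a i`,
parametrized by `(s : t) ↦ ∑ⱼ s^(a i - j) t^j e_(i,j)` (a point if `a i = 0`), where the `e_(i,j)`
form a basis of `ℂⁿ⁺¹`. The scroll is the union over `(s : t) ∈ ℙ¹` of the linear spans of the `d`
corresponding points. Not all `a i` are zero. -/
def IsRationalNormalScroll {n : ℕ} (S : Set (ProjSpace n)) : Prop :=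
  ∃ (d : ℕ) (a : Fin d → ℕ) (e : Module.Basis (Σ i : Fin d, Fin (a i + 1)) ℂ (Fin (n + 1) → ℂ)),
    (∃ i, 0 < a i) ∧
    S = {x | ∃ s t : ℂ, (s ≠ 0 ∨ t ≠ 0) ∧
      x.submodule ≤ Submodule.span ℂ (Set.range fun i : Fin d =>
        ∑ j : Fin (a i + 1), (s ^ (a i - (j : ℕ)) * t ^ (j : ℕ)) • e ⟨i, j⟩)}

/-- The closed subscheme of `ℙⁿ` defined by the homogeneous ideal `J` is a rational normal scroll:
its set of points is a rational normal scroll `S`, and `J` is the (radical) homogeneous ideal of `S`,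
so that the scheme structure is the reduced one. -/
def DefinesRationalNormalScroll {n : ℕ} (J : Ideal (CoordRing n)) : Prop :=
  ∃ S : Set (ProjSpace n), IsRationalNormalScroll S ∧
    zeroLocus (J : Set (CoordRing n)) = S ∧ vanishingIdeal S = J

end SyzScheme

end

/-! Write `d f = ∑ x_v g_v`, where the `g_v` span `G` and `dim G = p + 2`. Then `A(l) = ∑ l(g_v)
x_v` is an injective map from the dual of `G` to linear forms. Contraction with a volume element `Ω`
of `G` identifies `⋀^p G` with `⋀²` of the dual, so the quadrics generating `I_f` become an
alternating form `Q(l, l')`. The lowest square of the Koszul map says `A(x)Q(y,z) - A(y)Q(x,z) +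
A(z)Q(x,y) = 0`. The forms `A(l)` come from at least three independent ones, so exactness of the
Koszul complex gives a second linear map `B` with `Q(l, l') = A(l)B(l') - A(l')B(l)`: `I_f` is
generated by the minors of a `2 × (p+2)` matrix of linear forms (`exists_pencil`).

Every nontrivial combination of `A` and `B` is injective. Otherwise `B(l) = μ A(l)` for some `l ≠
0`, and `Q(l, l') = A(l)(B(l') - μ A(l'))` lies in `I_X`. As `X` is irreducible and non-degenerate,
this forces `B = μ A`; then all quadrics vanish and, by minimality of the resolution, `f = 0`,
against the rank.

A pencil of injective maps splits into Kronecker blocks (`IsInjectivePencil.exists_bases`), so in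
suitable coordinates the matrix is that of a standard scroll. Its minors generate the kernel of
`x_(i,j) ↦ t^j y_i` (`ker_scrollMap`), which gives the points, the full homogeneous ideal, primality
and, by counting monomials, the degree. The height is bounded above by Krull's theorem and below by
the chain of prime ideals obtained from a flag of subspaces of the dual of `G`. -/

namespace SyzScheme

open Module

/-! ### Pencils of injective linear maps -/

/-- All nontrivial linear combinations of `A` and `B` are injective. -/
def IsInjectivePencil {K U V : Type*} [Field K] [AddCommGroup U] [Module K U] [AddCommGroup V]
    [Module K V] (A B : U →ₗ[K] V) : Prop :=
  ∀ s t : K, (s ≠ 0 ∨ t ≠ 0) → ∀ u : U, s • A u + t • B u = 0 → u = 0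

section Kronecker

variable {K U V : Type} [Field K] [AddCommGroup U] [Module K U] [AddCommGroup V] [Module K V]

theorem IsInjectivePencil.injective_left {A B : U →ₗ[K] V} (h : IsInjectivePencil A B) :
    Function.Injective A :=
  (injective_iff_map_eq_zero A).2 fun u hu => h 1 0 (by simp) u (by simp [hu])

theorem IsInjectivePencil.domRestrict {A B : U →ₗ[K] V} (h : IsInjectivePencil A B)
    (W : Submodule K U) : IsInjectivePencil (A.domRestrict W) (B.domRestrict W) :=
  fun s t hst u hu => Subtype.ext (h s t hst u hu)

/-- The second map of a pencil of injective maps does not factor through the first. -/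
theorem IsInjectivePencil.not_range_le [IsAlgClosed K] [FiniteDimensional K U] [Nontrivial U]
    {A B : U →ₗ[K] V} (h : IsInjectivePencil A B) :
    ¬ LinearMap.range B ≤ LinearMap.range A := by
  intro hle
  let e := LinearEquiv.ofInjective A h.injective_left
  -- If the range of `B` lay in that of `A`, then `T = A⁻¹B` would be an endomorphism of `U`, and an
  -- eigenvector for the eigenvalue `c` would be killed by `B - cA`.
  let T : End K U := e.symm.toLinearMap ∘ₗ B.codRestrict (LinearMap.range A)
    (fun u => hle ⟨u, rfl⟩)
  obtain ⟨c, hc⟩ := End.exists_eigenvalue T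
  obtain ⟨u, hu⟩ := hc.exists_hasEigenvector
  have h1 : A (T u) = B u := by
    exact congrArg Subtype.val (e.apply_symm_apply (B.codRestrict _ (fun u => hle ⟨u, rfl⟩) u))
  refine hu.2 (h (-c) 1 (by simp) u ?_)
  rw [← h1, hu.apply_eq_smul]
  simp

/-- The Kronecker normal form of a pencil of injective maps, with blocks indexed by a finite type. -/
structure KroneckerBases (A B : U →ₗ[K] V) where
  ι : Type
  fin : Finite ι
  a : ι → ℕ
  e : Basis (Σ i : ι, Fin (a i + 1)) K V
  h : Basis (Σ i : ι, Fin (a i)) K U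
  left : ∀ i j, A (h ⟨i, j⟩) = e ⟨i, j.castSucc⟩
  right : ∀ i j, B (h ⟨i, j⟩) = e ⟨i, j.succ⟩

/-- The pencil induced on the preimage under `B` of the range of `A`. -/
def shrinkLeft (A B : U →ₗ[K] V) :
    (LinearMap.range A).comap B →ₗ[K] LinearMap.range A :=
  A.rangeRestrict.domRestrict _

def shrinkRight (A B : U →ₗ[K] V) :
    (LinearMap.range A).comap B →ₗ[K] LinearMap.range A :=
  B.restrict fun _ h => h

theorem KroneckerBases.of_subsingleton [FiniteDimensional K V] [Subsingleton U]
    (A B : U →ₗ[K] V) : Nonempty (KroneckerBases A B) := by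
  let f : Fin (finrank K V) ≃ Σ i : Fin (finrank K V), Fin (0 + 1) :=
    (Equiv.sigmaUnique (Fin (finrank K V)) (fun _ => Fin 1)).symm
  have : IsEmpty (Σ _ : Fin (finrank K V), Fin 0) := ⟨fun x => x.2.elim0⟩
  exact ⟨⟨Fin (finrank K V), inferInstance, fun _ => 0, (finBasis K V).reindex f, Basis.empty U,
    fun i j => j.elim0, fun i j => j.elim0⟩⟩

/-- Each block of the shrunk pencil grows by one step: its vectors `e`, pulled back along `A`, form
a basis of `U`, and the image under `B` of the last one is the new end of the block in `V`. What is
then missing from a basis of `V` forms blocks with `a = 0`. -/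
theorem KroneckerBases.of_shrink [FiniteDimensional K V]
    {A B : U →ₗ[K] V} (hA : Function.Injective A)
    (k : KroneckerBases (shrinkLeft A B) (shrinkRight A B)) :
    Nonempty (KroneckerBases A B) := by
  classical
  obtain ⟨ι, hfin, a, e, h, hl, hr⟩ := k
  let E := LinearEquiv.ofInjective A hA
  let h0 : Basis (Σ i : ι, Fin (a i + 1)) K U := e.map E.symm
  have hh0 : ∀ x, A (h0 x) = e x := fun x =>
    congrArg Subtype.val (E.apply_symm_apply (e x))
  have hh0' : ∀ i j, h0 ⟨i, Fin.castSucc j⟩ = h ⟨i, j⟩ := fun i j => by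
    apply hA
    rw [hh0, ← hl]
    rfl
  let w : ι → V := fun i => B (h0 ⟨i, Fin.last _⟩)
  -- A relation modulo the range of `A` puts a combination of the last vectors into the domain of
  -- the shrunk pencil. There `A` only reaches combinations of the non-last `e`, so all coefficients
  -- vanish.
  have hw : LinearIndependent K ((Submodule.Quotient.mk : V → V ⧸ LinearMap.range A) ∘ w) := by
    have := Fintype.ofFinite ι
    rw [Fintype.linearIndependent_iff]
    intro c hc i
    have h1 : B (∑ i, c i • h0 ⟨i, Fin.last _⟩) ∈ LinearMap.range A := by
      rw [← Submodule.Quotient.mk_eq_zero, ← hc]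
      simp only [map_sum, map_smul, Function.comp, w]
      rw [← Submodule.mkQ_apply, map_sum]
      simp
    let u : (LinearMap.range A).comap B := ⟨_, h1⟩
    have h2 : E (u : U) = ∑ i, c i • e ⟨i, Fin.last _⟩ := by
      simp only [u, map_sum, map_smul, h0, Basis.map_apply, LinearEquiv.apply_symm_apply]
    have h3 : e.repr (E (u : U)) ⟨i, Fin.last _⟩ = 0 := by
      have h4 : E (u : U) = shrinkLeft A B u := rfl
      rw [h4]
      have h5 : ∀ x : (LinearMap.range A).comap B,
          e.repr (shrinkLeft A B x) ⟨i, Fin.last _⟩ = 0 := by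
        intro x
        have h6 : (e.coord ⟨i, Fin.last _⟩) ∘ₗ (shrinkLeft A B) = 0 := by
          refine h.ext fun y => ?_
          obtain ⟨i', j⟩ := y
          simp only [LinearMap.comp_apply, hl, Basis.coord_apply, Basis.repr_self,
            LinearMap.zero_apply]
          rw [Finsupp.single_apply, if_neg]
          intro h7
          obtain ⟨rfl, h8⟩ := Sigma.mk.inj_iff.1 h7
          exact absurd (eq_of_heq h8) (Fin.castSucc_lt_last j).ne
        exact LinearMap.congr_fun h6 x
      exact h5 u
    rw [h2] at h3
    simp only [map_sum, map_smul, Basis.repr_self, Finsupp.coe_finsetSum, Finset.sum_apply,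
      Finsupp.smul_apply, Finsupp.single_apply, smul_eq_mul, mul_ite, mul_one, mul_zero] at h3
    rw [Finset.sum_eq_single i] at h3
    · simpa using h3
    · intro b _ hb
      rw [if_neg]
      intro h7
      exact hb (Sigma.mk.inj_iff.1 h7).1
    · simp
  let q := Basis.sumExtend hw
  have : Finite (ι ⊕ Basis.sumExtendIndex hw) := Module.Finite.finite_basis q
  have hq : ∀ i, q (Sum.inl i) = Submodule.Quotient.mk (w i) := fun i => by
    simp only [q, Basis.sumExtend]
    simp only [Basis.reindex_apply, Basis.extend_apply_self]
    rfl
  let κ := Basis.sumExtendIndex hw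
  choose r hr' using fun c : κ => Submodule.Quotient.mk_surjective _ (q (Sum.inr c))
  let g : ι ⊕ κ → V := Sum.elim w r
  have hg : (Submodule.Quotient.mk : V → V ⧸ LinearMap.range A) ∘ g = q := by
    funext x
    cases x with
    | inl i => simp [g, hq]
    | inr c => simp [g, hr']
  have hli := LinearIndependent.sumElim_of_quotient e.linearIndependent g
    (hg ▸ q.linearIndependent)
  have hsp : ⊤ ≤ Submodule.span K (Set.range (Sum.elim (fun x => (e x : V)) g)) := by
    have := Fintype.ofFinite ι
    have := Fintype.ofFinite (ι ⊕ κ)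
    rw [hli.span_eq_top_of_card_eq_finrank']
    rw [Fintype.card_sum, ← finrank_eq_card_basis e, ← finrank_eq_card_basis q, add_comm]
    exact Submodule.finrank_quotient_add_finrank _
  let b := Basis.mk hli hsp
  let a' : ι ⊕ κ → ℕ := Sum.elim (fun i => a i + 1) fun _ => 0
  let F : (Σ i : ι, Fin (a i + 1)) ⊕ (ι ⊕ κ) → Σ x : ι ⊕ κ, Fin (a' x + 1) :=
    Sum.elim (fun x => ⟨Sum.inl x.1, Fin.castSucc x.2⟩)
      (Sum.elim (fun i => ⟨Sum.inl i, Fin.last (a i + 1)⟩) fun c => ⟨Sum.inr c, 0⟩)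
  have hF : Function.Bijective F := by
    constructor
    · intro x y hxy
      have hx : (F x).1 = (F y).1 ∧ ((F x).2 : ℕ) = (F y).2 := by rw [hxy]; exact ⟨rfl, rfl⟩
      obtain ⟨i, j⟩ | i | c := x <;> obtain ⟨i', j'⟩ | i' | c' := y <;>
        simp only [F, Sum.elim_inl, Sum.elim_inr, Sum.inl.injEq, Fin.val_last,
          Sum.inr.injEq, reduceCtorEq, false_and] at hx
      · obtain ⟨rfl, hx⟩ := hx
        have hx : (j : ℕ) = j' := hx
        rw [Fin.ext hx]
      · obtain ⟨rfl, hx⟩ := hx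
        have hx : (j : ℕ) = a i + 1 := hx
        omega
      · obtain ⟨rfl, hx⟩ := hx
        have hx : a i + 1 = (j' : ℕ) := hx
        omega
      · rw [hx.1]
      · rw [hx.1]
    · rintro ⟨i | c, j⟩
      · change Fin (a i + 1 + 1) at j
        induction j using Fin.lastCases with
        | last => exact ⟨Sum.inr (Sum.inl i), rfl⟩
        | cast j => exact ⟨Sum.inl ⟨i, j⟩, rfl⟩
      · change Fin (0 + 1) at j
        exact ⟨Sum.inr (Sum.inr c), congrArg (Sigma.mk (Sum.inr c))
          (Subsingleton.elim (α := Fin 1) _ _)⟩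
  let b' : Basis (Σ x : ι ⊕ κ, Fin (a' x + 1)) K V := b.reindex (Equiv.ofBijective F hF)
  have hb' : ∀ x, b' (F x) = Sum.elim (fun x => (e x : V)) g x := fun x => by
    have : (Equiv.ofBijective F hF).symm (F x) = x :=
      (Equiv.ofBijective F hF).symm_apply_apply x
    simp [b', b, Basis.reindex_apply, this]
  let H : (Σ i : ι, Fin (a i + 1)) → Σ x : ι ⊕ κ, Fin (a' x) := fun x => ⟨Sum.inl x.1, x.2⟩
  have hH : Function.Bijective H := by
    constructor
    · rintro ⟨i, j⟩ ⟨i', j'⟩ hxy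
      have hx : (H ⟨i, j⟩).1 = (H ⟨i', j'⟩).1 ∧ ((H ⟨i, j⟩).2 : ℕ) = (H ⟨i', j'⟩).2 := by
        rw [hxy]; exact ⟨rfl, rfl⟩
      simp only [H, Sum.inl.injEq] at hx
      obtain ⟨rfl, hx⟩ := hx
      rw [Fin.ext hx]
    · rintro ⟨i | c, j⟩
      · exact ⟨⟨i, j⟩, rfl⟩
      · exact j.elim0
  let h' : Basis (Σ x : ι ⊕ κ, Fin (a' x)) K U := h0.reindex (Equiv.ofBijective H hH)
  have hh' : ∀ x, h' (H x) = h0 x := fun x => by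
    have : (Equiv.ofBijective H hH).symm (H x) = x :=
      (Equiv.ofBijective H hH).symm_apply_apply x
    simp [h', Basis.reindex_apply, this]
  refine ⟨⟨ι ⊕ κ, inferInstance, a', b', h', ?_, ?_⟩⟩
  · rintro (i | c) j
    · have := hb' (Sum.inl ⟨i, j⟩)
      exact (congrArg A (hh' ⟨i, j⟩)).trans ((hh0 _).trans this.symm)
    · exact j.elim0
  · rintro (i | c) j
    · change Fin (a i + 1) at j
      refine (congrArg B (hh' ⟨i, j⟩)).trans ?_
      induction j using Fin.lastCases with
      | last => exact (hb' (Sum.inr (Sum.inl i))).symm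
      | cast j =>
        refine Eq.trans ?_ (hb' (Sum.inl ⟨i, j.succ⟩)).symm
        rw [hh0']
        exact congrArg Subtype.val (hr i j)
    · exact j.elim0

/-- Induction on the dimension of `U`: by `not_range_le` the preimage under `B` of the range of `A`
is a proper subspace, and the pencil induced there is again injective. The spaces are quantified
inside because they change at each step. -/
theorem IsInjectivePencil.kroneckerBases [IsAlgClosed K] :
    ∀ (N : ℕ) {U V : Type} [AddCommGroup U] [Module K U] [AddCommGroup V] [Module K V]
      [FiniteDimensional K U] [FiniteDimensional K V] {A B : U →ₗ[K] V},
      IsInjectivePencil A B → finrank K U ≤ N → Nonempty (KroneckerBases A B)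
  | 0, U, V, _, _, _, _, _, _, A, B, h, hN => by
    have : Subsingleton U := finrank_zero_iff.1 (Nat.le_zero.1 hN)
    exact KroneckerBases.of_subsingleton A B
  | N + 1, U, V, _, _, _, _, _, _, A, B, h, hN => by
    rcases subsingleton_or_nontrivial U with hU | hU
    · exact KroneckerBases.of_subsingleton A B
    · have hlt : finrank K ((LinearMap.range A).comap B) < finrank K U := by
        apply Submodule.finrank_lt
        intro htop
        refine h.not_range_le ?_
        rintro _ ⟨u, rfl⟩
        exact (htop ▸ Submodule.mem_top : u ∈ (LinearMap.range A).comap B)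
      have h' : IsInjectivePencil (shrinkLeft A B) (shrinkRight A B) := fun s t hst u hu =>
        Subtype.ext (h s t hst u (congrArg Subtype.val hu))
      obtain ⟨k⟩ := IsInjectivePencil.kroneckerBases N h' (by omega)
      exact KroneckerBases.of_shrink h.injective_left k

/-- A pencil of injective maps has a Kronecker normal form. -/
theorem IsInjectivePencil.exists_bases [IsAlgClosed K] [FiniteDimensional K U]
    [FiniteDimensional K V] {A B : U →ₗ[K] V} (h : IsInjectivePencil A B) :
    ∃ (d : ℕ) (a : Fin d → ℕ) (e : Basis (Σ i, Fin (a i + 1)) K V)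
      (b : Basis (Σ i, Fin (a i)) K U),
      (∀ i j, A (b ⟨i, j⟩) = e ⟨i, j.castSucc⟩) ∧ ∀ i j, B (b ⟨i, j⟩) = e ⟨i, j.succ⟩ := by
  obtain ⟨ι, hfin, a, e, b, hl, hr⟩ := IsInjectivePencil.kroneckerBases _ h le_rfl
  obtain ⟨d, ⟨f⟩⟩ := Finite.exists_equiv_fin ι
  let F : (Σ i : Fin d, Fin (a (f.symm i) + 1)) ≃ Σ i, Fin (a i + 1) :=
    Equiv.sigmaCongrLeft (β := fun i => Fin (a i + 1)) f.symm
  let G : (Σ i : Fin d, Fin (a (f.symm i))) ≃ Σ i, Fin (a i) :=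
    Equiv.sigmaCongrLeft (β := fun i => Fin (a i)) f.symm
  refine ⟨d, fun i => a (f.symm i), e.reindex F.symm, b.reindex G.symm, ?_, ?_⟩
  · intro i j
    simp only [Basis.reindex_apply, Equiv.symm_symm]
    exact hl _ _
  · intro i j
    simp only [Basis.reindex_apply, Equiv.symm_symm]
    exact hr _ _

end Kronecker

/-! ### The toric description of the standard scroll -/

section Multisets

variable {ι : Type*} {a : ι → ℕ}

/-- The sum of the second indices of a multiset of variables of a scroll. -/
def idxSum (s : Multiset (Σ i, Fin (a i + 1))) : ℕ := (s.map fun p => (p.2 : ℕ)).sum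

theorem idxSum_zero : idxSum (0 : Multiset (Σ i, Fin (a i + 1))) = 0 := rfl

theorem idxSum_cons (p : Σ i, Fin (a i + 1)) (s) : idxSum (p ::ₘ s) = p.2 + idxSum s := by
  simp [idxSum]

theorem idxSum_le (s : Multiset (Σ i, Fin (a i + 1))) :
    idxSum s ≤ ((s.map Sigma.fst).map a).sum := by
  induction s using Multiset.induction with
  | empty => simp [idxSum_zero]
  | cons p s ih =>
    rw [idxSum_cons, Multiset.map_cons, Multiset.map_cons, Multiset.sum_cons]
    exact add_le_add (Nat.le_of_lt_succ p.2.2) ih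

/-- Greedy choice: each variable in turn takes as much of `T` as its block allows. Together with
`idxSum_le`, this determines the exponents of `t` that occur with a given product of the `y_i`. -/
theorem exists_idxSum_eq (C : Multiset ι) : ∀ T ≤ (C.map a).sum,
    ∃ s : Multiset (Σ i, Fin (a i + 1)), s.map Sigma.fst = C ∧ idxSum s = T := by
  induction C using Multiset.induction with
  | empty => intro T hT; exact ⟨0, rfl, (Nat.le_zero.1 hT).symm⟩
  | cons i C ih =>
    intro T hT
    rw [Multiset.map_cons, Multiset.sum_cons] at hT
    obtain ⟨s, hs, hs'⟩ := ih (T - min T (a i)) (by omega)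
    refine ⟨⟨i, ⟨min T (a i), by omega⟩⟩ ::ₘ s, by simp [hs], ?_⟩
    rw [idxSum_cons, hs']
    simp only
    omega

variable {M : Type*} [CommMonoid M] {x : (Σ i, Fin (a i + 1)) → M}

/-- The relations between the variables of a scroll. -/
def ScrollRelations (x : (Σ i, Fin (a i + 1)) → M) : Prop :=
  ∀ (i : ι) (j : Fin (a i)) (i' : ι) (j' : Fin (a i')),
    x ⟨i, j.castSucc⟩ * x ⟨i', j'.succ⟩ = x ⟨i', j'.castSucc⟩ * x ⟨i, j.succ⟩

/-- One scroll relation raises the chosen second index by one and lowers that of another variable by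
one. The bound on `j` ensures that a variable with positive index remains at each of the `k` steps.
-/
theorem ScrollRelations.exists_cons_of_le (hx : ScrollRelations x) {i : ι} (j : Fin (a i + 1)) :
    ∀ (k : ℕ) (j' : Fin (a i + 1)) (w : Multiset (Σ i, Fin (a i + 1))), (j : ℕ) = j' + k →
      (j : ℕ) ≤ j' + idxSum w →
      ∃ w' : Multiset (Σ i, Fin (a i + 1)), w'.map Sigma.fst = w.map Sigma.fst ∧
        j + idxSum w' = j' + idxSum w ∧ x ⟨i, j'⟩ * (w.map x).prod = x ⟨i, j⟩ * (w'.map x).prod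
  | 0, j', w, hk, _ => by
    obtain rfl : j = j' := Fin.ext hk
    exact ⟨w, rfl, rfl, rfl⟩
  | k + 1, j', w, hk, hle => by
    have hw : ∃ p ∈ w, 0 < (p.2 : ℕ) := by
      by_contra! hcon
      have : idxSum w = 0 := by
        rw [idxSum, Multiset.sum_eq_zero_iff]
        intro t ht
        obtain ⟨p, hp, rfl⟩ := Multiset.mem_map.1 ht
        exact Nat.le_zero.1 (hcon p hp)
      omega
    obtain ⟨⟨i', l⟩, hp, hl⟩ := hw
    obtain ⟨v, rfl⟩ := Multiset.exists_cons_of_mem hp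
    simp only at hl
    have hl2 := l.2
    have hj2 := j.2
    let l' : Fin (a i') := ⟨l - 1, by omega⟩
    let m : Fin (a i) := ⟨j', by omega⟩
    have hl' : l = l'.succ := Fin.ext (by simp [l']; omega)
    have hm : j' = m.castSucc := Fin.ext rfl
    have hv : (l'.castSucc : ℕ) = l - 1 := rfl
    have hms : (m.succ : ℕ) = j' + 1 := rfl
    simp only [idxSum_cons] at hle
    obtain ⟨w', h1, h2, h3⟩ := hx.exists_cons_of_le j k m.succ (⟨i', l'.castSucc⟩ ::ₘ v)
      (by omega) (by simp only [idxSum_cons]; omega)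
    refine ⟨w', by simpa using h1, ?_, ?_⟩
    · simp only [idxSum_cons] at h2 ⊢
      omega
    · rw [← h3, Multiset.map_cons, Multiset.map_cons, Multiset.prod_cons, Multiset.prod_cons,
        ← mul_assoc, ← mul_assoc, hl', hm, hx i m i' l', mul_comm (x ⟨i, m.succ⟩)]

/-- The mirror image: the chosen index goes down and another goes up, the bound ensuring that some
other variable is not yet at the end of its block. -/
theorem ScrollRelations.exists_cons_of_ge (hx : ScrollRelations x) {i : ι} (j : Fin (a i + 1)) :
    ∀ (k : ℕ) (j' : Fin (a i + 1)) (w : Multiset (Σ i, Fin (a i + 1))), (j' : ℕ) = j + k →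
      j' + idxSum w ≤ j + ((w.map Sigma.fst).map a).sum →
      ∃ w' : Multiset (Σ i, Fin (a i + 1)), w'.map Sigma.fst = w.map Sigma.fst ∧
        j + idxSum w' = j' + idxSum w ∧ x ⟨i, j'⟩ * (w.map x).prod = x ⟨i, j⟩ * (w'.map x).prod
  | 0, j', w, hk, _ => by
    obtain rfl : j' = j := Fin.ext hk
    exact ⟨w, rfl, rfl, rfl⟩
  | k + 1, j', w, hk, hle => by
    have hw : ∃ p ∈ w, (p.2 : ℕ) < a p.1 := by
      by_contra! hcon
      have : idxSum w = ((w.map Sigma.fst).map a).sum := by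
        rw [idxSum, Multiset.map_map]
        refine congrArg _ (Multiset.map_congr rfl fun p hp => ?_)
        have := hcon p hp
        have := p.2.2
        simp only [Function.comp]
        omega
      omega
    obtain ⟨⟨i', l⟩, hp, hl⟩ := hw
    obtain ⟨v, rfl⟩ := Multiset.exists_cons_of_mem hp
    simp only at hl
    have hj2 := j'.2
    let l' : Fin (a i') := ⟨l, hl⟩
    let m : Fin (a i) := ⟨j' - 1, by omega⟩
    have hl' : l = l'.castSucc := Fin.ext rfl
    have hm : j' = m.succ := Fin.ext (by simp [m]; omega)
    have hv : (l'.succ : ℕ) = l + 1 := rfl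
    have hms : (m.castSucc : ℕ) = j' - 1 := rfl
    simp only [idxSum_cons] at hle
    obtain ⟨w', h1, h2, h3⟩ := hx.exists_cons_of_ge j k m.castSucc (⟨i', l'.succ⟩ ::ₘ v)
      (by omega) (by
        simp only [idxSum_cons, Multiset.map_cons, Multiset.sum_cons] at hle ⊢
        omega)
    refine ⟨w', by simpa using h1, ?_, ?_⟩
    · simp only [idxSum_cons] at h2 ⊢
      omega
    · rw [← h3, Multiset.map_cons, Multiset.map_cons, Multiset.prod_cons, Multiset.prod_cons,
        ← mul_assoc, ← mul_assoc, hl', hm, mul_comm (x ⟨i, m.succ⟩),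
        hx i m i' l']

/-- Two monomials of the same type agree modulo the relations of the scroll. -/
theorem ScrollRelations.prod_eq (hx : ScrollRelations x) (s' : Multiset (Σ i, Fin (a i + 1))) :
    ∀ s : Multiset (Σ i, Fin (a i + 1)), s.map Sigma.fst = s'.map Sigma.fst →
      idxSum s = idxSum s' → (s.map x).prod = (s'.map x).prod := by
  induction s' using Multiset.induction with
  | empty =>
    intro s hs _
    rw [Multiset.map_zero, Multiset.map_eq_zero] at hs
    rw [hs]
  | cons p s' ih =>
    intro s hs hs'
    obtain ⟨i, j⟩ := p
    have hi : i ∈ s.map Sigma.fst := by rw [hs]; simp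
    obtain ⟨⟨i', j'⟩, hq, hqi⟩ := Multiset.mem_map.1 hi
    obtain rfl : i' = i := hqi
    obtain ⟨w, rfl⟩ := Multiset.exists_cons_of_mem hq
    have hww : w.map Sigma.fst = s'.map Sigma.fst := by simpa using hs
    rw [idxSum_cons, idxSum_cons] at hs'
    simp only at hs'
    -- The variable of block `i'` is moved to the required index `j`, the others absorbing the
    -- difference; then it matches the head of `s'` and the induction hypothesis applies to the
    -- rest.
    have : ∃ w' : Multiset (Σ i, Fin (a i + 1)), w'.map Sigma.fst = w.map Sigma.fst ∧
        j + idxSum w' = j' + idxSum w ∧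
        x ⟨i', j'⟩ * (w.map x).prod = x ⟨i', j⟩ * (w'.map x).prod := by
      rcases le_total (j' : ℕ) j with h | h
      · exact hx.exists_cons_of_le j (j - j') j' w (by omega) (by omega)
      · refine hx.exists_cons_of_ge j (j' - j) j' w (by omega) ?_
        have := idxSum_le s'
        rw [hww]
        omega
    obtain ⟨w', h1, h2, h3⟩ := this
    rw [Multiset.map_cons, Multiset.map_cons, Multiset.prod_cons, Multiset.prod_cons, h3,
      ih w' (h1.trans hww) (by omega)]

end Multisets

section Toric

open MvPolynomial

theorem monomial_one_eq_prod {σ R : Type*} [CommSemiring R] (m : σ →₀ ℕ) :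
    monomial m (1 : R) = ((Finsupp.toMultiset m).map X).prod := by
  induction m using Finsupp.induction_linear with
  | zero => simp
  | add f g hf hg => rw [map_add, Multiset.map_add, Multiset.prod_add, ← hf, ← hg]; simp
  | single i k => simp [Finsupp.toMultiset_single, X_pow_eq_monomial, Multiset.map_nsmul,
      Multiset.prod_nsmul]

/-- The kernel of a monomial map is contained in every ideal containing the differences of monomials
with equal images. -/
theorem ker_le_of_monomial_map {σ τ R : Type*} [CommRing R]
    (ψ : MvPolynomial σ R →ₐ[R] MvPolynomial τ R) (W : (σ →₀ ℕ) → (τ →₀ ℕ))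
    (hψ : ∀ m, ψ (monomial m 1) = monomial (W m) 1) (J : Ideal (MvPolynomial σ R))
    (hJ : ∀ m m', W m = W m' → monomial m (1 : R) - monomial m' 1 ∈ J) :
    RingHom.ker ψ ≤ J := by
  -- A set-theoretic section of the exponent map extends to a linear map `ρ` on polynomials with `F
  -- ≡ ρ(ψ F)` modulo `J`, which is checked on monomials.
  let r : (τ →₀ ℕ) → (σ →₀ ℕ) := Function.invFun W
  have hr : ∀ m, W (r (W m)) = W m := fun m => Function.invFun_eq ⟨m, rfl⟩
  let ρ : MvPolynomial τ R →ₗ[R] MvPolynomial σ R :=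
    (basisMonomials τ R).constr R fun t => monomial (r t) 1
  have hρ : ∀ t, ρ (monomial t 1) = monomial (r t) 1 := fun t => by
    have := (basisMonomials τ R).constr_basis R (fun t => monomial (r t) (1 : R)) t
    rwa [coe_basisMonomials] at this
  have key : ∀ F, F - ρ (ψ F) ∈ J := by
    intro F
    induction F using MvPolynomial.induction_on' with
    | monomial m c =>
      have h1 : monomial m c = c • monomial m (1 : R) := by simp [smul_monomial]
      rw [h1, map_smul, map_smul, hψ, hρ, ← smul_sub, smul_eq_C_mul]
      exact J.mul_mem_left _ (hJ _ _ (hr _).symm)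
    | add F G hF hG =>
      rw [map_add, map_add, add_sub_add_comm]
      exact J.add_mem hF hG
  intro F hF
  have := key F
  rwa [RingHom.mem_ker.1 hF, map_zero, sub_zero] at this

variable {ι : Type*} (a : ι → ℕ)

/-- The parametrization `x_(i,j) ↦ t^j y_i` of the standard scroll. -/
noncomputable def scrollMap : MvPolynomial (Σ i, Fin (a i + 1)) ℂ →ₐ[ℂ] MvPolynomial (Option ι) ℂ :=
  aeval fun p => X none ^ (p.2 : ℕ) * X (some p.1)

/-- The ideal of the minors of the matrix of the standard scroll. -/
noncomputable def scrollIdeal : Ideal (MvPolynomial (Σ i, Fin (a i + 1)) ℂ) :=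
  Ideal.span {F | ∃ (i : ι) (j : Fin (a i)) (i' : ι) (j' : Fin (a i')),
    F = X ⟨i, j.castSucc⟩ * X ⟨i', j'.succ⟩ - X ⟨i', j'.castSucc⟩ * X ⟨i, j.succ⟩}

/-- The exponent vector of `t ^ T * ∏ i ∈ C, y_i`. -/
noncomputable def encode (C : Multiset ι) (T : ℕ) : Option ι →₀ ℕ :=
  open scoped Classical in
  (Multiset.toFinsupp C).mapDomain some + Finsupp.single none T

variable {a} in
theorem encode_inj {C C' : Multiset ι} {T T' : ℕ} (h : encode C T = encode C' T') :
    C = C' ∧ T = T' := by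
  classical
  have h1 : T = T' := by
    have := DFunLike.congr_fun h none
    simpa [encode, Finsupp.mapDomain_of_notMem_range] using this
  subst h1
  refine ⟨?_, rfl⟩
  have h2 := add_right_cancel h
  exact Multiset.toFinsupp.injective
    (Finsupp.mapDomain_injective (Option.some_injective _) h2)

theorem encode_add (C C' : Multiset ι) (T T' : ℕ) :
    encode (C + C') (T + T') = encode C T + encode C' T' := by
  classical
  simp only [encode, map_add, Finsupp.mapDomain_add, Finsupp.single_add]
  abel

theorem scrollMap_monomial (m : (Σ i, Fin (a i + 1)) →₀ ℕ) :
    scrollMap a (monomial m 1) =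
      monomial (encode ((Finsupp.toMultiset m).map Sigma.fst) (idxSum (Finsupp.toMultiset m))) 1 := by
  classical
  rw [monomial_one_eq_prod, map_multiset_prod]
  induction Finsupp.toMultiset m using Multiset.induction with
  | empty => simp [idxSum_zero, encode]
  | cons p s ih =>
    rw [Multiset.map_cons, Multiset.map_cons, Multiset.prod_cons, ih, Multiset.map_cons,
      idxSum_cons, ← Multiset.singleton_add, encode_add]
    simp only [scrollMap, aeval_X, encode, Multiset.toFinsupp_singleton, Finsupp.mapDomain_single]
    rw [X_pow_eq_monomial, X, monomial_mul, monomial_mul, add_comm (Finsupp.single none _)]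
    simp

/-- The ideal of minors of the standard scroll is the kernel of its parametrization. -/
theorem ker_scrollMap : RingHom.ker (scrollMap a) = scrollIdeal a := by
  apply le_antisymm
  · refine ker_le_of_monomial_map _ _ (scrollMap_monomial a) _ fun m m' h => ?_
    obtain ⟨h1, h2⟩ := encode_inj h
    -- Modulo the minors, the classes of the variables satisfy the scroll relations, so a monomial
    -- depends only on its blocks and its index sum.
    rw [← Ideal.Quotient.eq, monomial_one_eq_prod, monomial_one_eq_prod, map_multiset_prod,
      map_multiset_prod, Multiset.map_map, Multiset.map_map]
    refine ScrollRelations.prod_eq ?_ _ _ h1 h2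
    intro i j i' j'
    simp only [Function.comp]
    rw [← map_mul, ← map_mul, Ideal.Quotient.eq]
    exact Ideal.subset_span ⟨i, j, i', j', rfl⟩
  · rw [scrollIdeal, Ideal.span_le]
    rintro _ ⟨i, j, i', j', rfl⟩
    rw [SetLike.mem_coe, RingHom.mem_ker]
    simp only [scrollMap, map_sub, map_mul, aeval_X, Fin.val_castSucc, Fin.val_succ]
    ring

end Toric

/-! ### The Hilbert function of the standard scroll -/

section Counting

variable {ι : Type*} [Fintype ι] [DecidableEq ι]

/-- Only multisets containing `i` contribute, and these arise uniquely by adding one `i` to a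
multiset of size `m`. -/
theorem sum_count_sym_succ (i : ι) (m : ℕ) :
    ∑ C : Sym ι (m + 1), (C : Multiset ι).count i =
      Fintype.card (Sym ι m) + ∑ C : Sym ι m, (C : Multiset ι).count i := by
  have h1 : ∑ C : Sym ι (m + 1), (C : Multiset ι).count i =
      ∑ C ∈ Finset.univ.image (fun C : Sym ι m => i ::ₛ C), (C : Multiset ι).count i := by
    symm
    refine Finset.sum_subset (Finset.subset_univ _) fun C _ hC => ?_
    rw [Multiset.count_eq_zero]
    intro hi
    exact hC (Finset.mem_image.2 ⟨C.erase i hi, Finset.mem_univ _, Sym.cons_erase hi⟩)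
  rw [h1, Finset.sum_image fun C _ C' _ h => Sym.cons_inj_right i C C' |>.1 h]
  simp only [Sym.coe_cons, Multiset.count_cons_self, Finset.sum_add_distrib, Finset.sum_const,
    Finset.card_univ, smul_eq_mul, mul_one, add_comm]

theorem sum_count_sym {e : ℕ} (he : Fintype.card ι = e + 1) (i : ι) (m : ℕ) :
    ∑ C : Sym ι m, (C : Multiset ι).count i = (m + e).choose (e + 1) := by
  induction m with
  | zero =>
    rw [zero_add, Nat.choose_eq_zero_of_lt (Nat.lt_succ_self e)]
    refine Finset.sum_eq_zero fun C _ => ?_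
    have : (C : Multiset ι) = 0 := Multiset.card_eq_zero.1 C.2
    rw [this, Multiset.count_zero]
  | succ m ih =>
    rw [sum_count_sym_succ, ih, Sym.card_sym_eq_choose, he, add_right_comm m 1 e,
      Nat.choose_succ_succ]
    congr 1
    rw [show e + 1 + m - 1 = m + e by omega]
    exact Nat.choose_symm_of_eq_add rfl

/-- A product of `m` variables `y_i` with blocks `C` occurs with the exponents `0, …, ∑ a` of `t`.
The sum thus counts the monomials in the image of the forms of degree `m`. -/
theorem sum_sym_eq {e : ℕ} (he : Fintype.card ι = e + 1) (a : ι → ℕ) (m : ℕ) :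
    ∑ C : Sym ι m, (((C : Multiset ι).map a).sum + 1) =
      (m + e).choose e + (∑ i, a i) * (m + e).choose (e + 1) := by
  have h1 : ∀ C : Sym ι m, ((C : Multiset ι).map a).sum = ∑ i, (C : Multiset ι).count i * a i := by
    intro C
    rw [Finset.sum_multiset_map_count]
    simp only [smul_eq_mul]
    refine Finset.sum_subset (Finset.subset_univ _) fun i _ hi => ?_
    rw [Multiset.count_eq_zero.2 (by simpa using hi), zero_mul]
  simp only [h1, Finset.sum_add_distrib, Finset.sum_const, Finset.card_univ, smul_eq_mul, mul_one]
  rw [Finset.sum_comm, add_comm, Sym.card_sym_eq_choose, he,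
    show e + 1 + m - 1 = m + e by omega, Nat.choose_symm_of_eq_add (show m + e = m + e from rfl),
    Finset.sum_mul]
  congr 1
  refine Finset.sum_congr rfl fun i _ => ?_
  rw [← Finset.sum_mul, sum_count_sym he, mul_comm]

end Counting

section Hilbert

open MvPolynomial

variable {ι : Type*} [DecidableEq ι] (a : ι → ℕ)

theorem card_toMultiset_eq_degree {σ : Type*} (m : σ →₀ ℕ) :
    Multiset.card (Finsupp.toMultiset m) = m.degree := by
  rw [Finsupp.card_toMultiset]
  rfl

/-- The image of the forms of degree `m` under the parametrization of the standard scroll. -/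
theorem map_scrollMap_homogeneousSubmodule (m : ℕ) :
    (homogeneousSubmodule (Σ i, Fin (a i + 1)) ℂ m).map (scrollMap a).toLinearMap =
      Submodule.span ℂ (Set.range fun x : Σ C : Sym ι m, Fin (((C : Multiset ι).map a).sum + 1) =>
        (monomial (encode (x.1 : Multiset ι) x.2) 1 : MvPolynomial (Option ι) ℂ)) := by
  apply le_antisymm
  · rintro _ ⟨F, hF, rfl⟩
    rw [F.as_sum, map_sum]
    refine Submodule.sum_mem _ fun s hs => ?_
    have h1 : monomial s (coeff s F) = coeff s F • monomial s (1 : ℂ) := by simp [smul_monomial]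
    rw [h1, map_smul]
    refine Submodule.smul_mem _ _ (Submodule.subset_span ?_)
    have h2 : s.degree = m := by
      have := (mem_homogeneousSubmodule m F).1 hF (mem_support_iff.1 hs)
      rwa [Finsupp.degree_eq_weight_one]
    refine ⟨⟨⟨(Finsupp.toMultiset s).map Sigma.fst, ?_⟩, ⟨idxSum (Finsupp.toMultiset s), ?_⟩⟩, ?_⟩
    · rw [Multiset.card_map, card_toMultiset_eq_degree, h2]
    · exact Nat.lt_succ_of_le (idxSum_le _)
    · exact (scrollMap_monomial a s).symm
  · rw [Submodule.span_le]
    rintro _ ⟨⟨⟨C, hC⟩, ⟨T, hT⟩⟩, rfl⟩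
    obtain ⟨s, hs, hs'⟩ := exists_idxSum_eq C T (Nat.le_of_lt_succ hT)
    classical
    refine ⟨monomial (Multiset.toFinsupp s) 1, ?_, ?_⟩
    · refine isHomogeneous_monomial _ ?_
      rw [← card_toMultiset_eq_degree, Multiset.toFinsupp_toMultiset, ← hC, ← hs,
        Multiset.card_map]
    · refine (scrollMap_monomial a _).trans ?_
      rw [Multiset.toFinsupp_toMultiset, hs, hs']
      rfl

theorem finrank_map_scrollMap [Fintype ι] {e : ℕ} (he : Fintype.card ι = e + 1) (m : ℕ) :
    finrank ℂ ((homogeneousSubmodule (Σ i, Fin (a i + 1)) ℂ m).map (scrollMap a).toLinearMap) =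
      (m + e).choose e + (∑ i, a i) * (m + e).choose (e + 1) := by
  rw [map_scrollMap_homogeneousSubmodule, finrank_span_eq_card, Fintype.card_sigma]
  · simp only [Fintype.card_fin]
    exact sum_sym_eq he a m
  · have := (basisMonomials (Option ι) ℂ).linearIndependent.comp
      (fun x : Σ C : Sym ι m, Fin (((C : Multiset ι).map a).sum + 1) =>
        encode (x.1 : Multiset ι) x.2) ?_
    · simpa [Function.comp_def] using this
    · rintro ⟨C, T⟩ ⟨C', T'⟩ h
      obtain ⟨h1, h2⟩ := encode_inj h
      obtain rfl : C = C' := Subtype.ext h1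
      exact congrArg _ (Fin.ext h2)

/-- The second binomial is a polynomial in `m` of degree `e + 1` with leading coefficient
`1/(e+1)!`, and it dominates the first one. -/
theorem HasDegree.of_hilbertFunction {n e N : ℕ} {J : Ideal (CoordRing n)} (hN : N ≠ 0)
    (h : ∀ m, hilbertFunction J m = (m + e).choose e + N * (m + e).choose (e + 1)) :
    HasDegree J N := by
  have hd : (Polynomial.preHilbertPoly ℚ e 0).degree <
      ((N : ℚ) • Polynomial.preHilbertPoly ℚ (e + 1) 1).degree := by
    rw [Polynomial.degree_smul_of_smul_regular _ (IsSMulRegular.of_ne_zero (by exact_mod_cast hN))]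
    apply Polynomial.degree_lt_degree
    rw [Polynomial.natDegree_preHilbertPoly, Polynomial.natDegree_preHilbertPoly]
    exact Nat.lt_succ_self e
  refine ⟨Polynomial.preHilbertPoly ℚ e 0 + (N : ℚ) • Polynomial.preHilbertPoly ℚ (e + 1) 1,
    ?_, ?_⟩
  · filter_upwards [Filter.eventually_ge_atTop 1] with m hm
    rw [h, Polynomial.eval_add, Polynomial.eval_smul,
      Polynomial.preHilbertPoly_eq_choose_sub_add _ _ (Nat.zero_le m),
      Polynomial.preHilbertPoly_eq_choose_sub_add _ _ hm, Nat.sub_zero,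
      show m - 1 + (e + 1) = m + e by omega]
    push_cast
    rfl
  · rw [Polynomial.leadingCoeff_add_of_degree_lt hd,
      Polynomial.natDegree_add_eq_right_of_degree_lt hd, Polynomial.natDegree_smul _
      (by exact_mod_cast hN), Polynomial.leadingCoeff_smul_of_smul_regular _
      (IsSMulRegular.of_ne_zero (by exact_mod_cast hN)), Polynomial.natDegree_preHilbertPoly,
      Polynomial.leadingCoeff_preHilbertPoly, smul_eq_mul]
    have : ((e + 1).factorial : ℚ) ≠ 0 := by exact_mod_cast Nat.factorial_ne_zero _
    field_simp

end Hilbert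

end SyzScheme

namespace SyzScheme

open Module MvPolynomial

/-! ### Linear forms and changes of coordinates -/

section LinearForms

variable {n : ℕ}

/-- The linear form with a given vector of coefficients. -/
noncomputable def linForm : (Fin (n + 1) → ℂ) →ₗ[ℂ] CoordRing n :=
  Fintype.linearCombination ℂ (fun v => (X v : CoordRing n))

theorem linForm_apply (c : Fin (n + 1) → ℂ) : linForm c = ∑ v, c v • (X v : CoordRing n) :=
  Fintype.linearCombination_apply ..

theorem linForm_single (v : Fin (n + 1)) : linForm (Pi.single v 1) = (X v : CoordRing n) := by
  rw [linForm, Fintype.linearCombination_apply_single, one_smul]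

theorem isHomogeneous_linForm (c : Fin (n + 1) → ℂ) : (linForm c).IsHomogeneous 1 := by
  rw [linForm_apply]
  refine IsHomogeneous.sum _ _ _ fun v _ => ?_
  exact (homogeneousSubmodule _ ℂ 1).smul_mem _ (isHomogeneous_X _ _)

theorem coeff_linForm (c : Fin (n + 1) → ℂ) (v : Fin (n + 1)) :
    coeff (Finsupp.single v 1) (linForm c) = c v := by
  rw [linForm_apply, coeff_sum]
  simp [coeff_X, Finsupp.single_left_inj]

theorem exists_linForm_eq {F : CoordRing n} (hF : F.IsHomogeneous 1) : ∃ c, linForm c = F := by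
  have h : F ∈ LinearMap.range (linForm (n := n)) := by
    rw [linForm, Fintype.range_linearCombination, ← homogeneousSubmodule_one_eq_span_X]
    exact hF
  exact h

theorem eval_linForm (c v : Fin (n + 1) → ℂ) : eval v (linForm c) = c ⬝ᵥ v := by
  rw [linForm_apply, map_sum, dotProduct]
  simp [smul_eval]

variable {σ : Type*} [Fintype σ] (e : Basis σ ℂ (Fin (n + 1) → ℂ))

/-- The linear change of coordinates sending the variables to a basis of the linear forms. -/
noncomputable def coordEquiv : MvPolynomial σ ℂ ≃ₐ[ℂ] CoordRing n :=
  AlgEquiv.ofAlgHom (aeval fun s => linForm (e s))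
    (aeval fun v => ∑ s, e.repr (Pi.single v 1) s • X s)
    (by
      ext1 v
      simp only [AlgHom.comp_apply, aeval_X, map_sum, map_smul, AlgHom.id_apply]
      rw [← linForm_single]
      simp only [← map_smul, ← map_sum]
      rw [e.sum_repr])
    (by
      ext1 s
      simp only [AlgHom.comp_apply, aeval_X, AlgHom.id_apply]
      rw [linForm_apply, map_sum]
      simp only [map_smul, aeval_X, Finset.smul_sum, smul_smul]
      rw [Finset.sum_comm]
      simp only [← Finset.sum_smul]
      have h : ∀ s', ∑ v, e s v * e.repr (Pi.single v 1) s' = e.repr (e s) s' := fun s' => by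
        conv_rhs => rw [pi_eq_sum_univ' (e s)]
        simp [Finsupp.finsetSum_apply]
      simp only [h, e.repr_self]
      classical
      rw [Finset.sum_eq_single s]
      · simp
      · intro b _ hb; simp [hb.symm]
      · simp)

theorem coordEquiv_X (s : σ) : coordEquiv e (X s) = linForm (e s) := by
  simp [coordEquiv]

theorem isHomogeneous_coordEquiv {F : MvPolynomial σ ℂ} {m : ℕ} (hF : F.IsHomogeneous m) :
    (coordEquiv e F).IsHomogeneous m := by
  have := hF.aeval (fun s => linForm (e s)) (fun s => isHomogeneous_linForm _)
  rwa [one_mul] at this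

theorem isHomogeneous_coordEquiv_symm {F : CoordRing n} {m : ℕ} (hF : F.IsHomogeneous m) :
    ((coordEquiv e).symm F).IsHomogeneous m := by
  have := hF.aeval (fun v => ∑ s, e.repr (Pi.single v 1) s • (X s : MvPolynomial σ ℂ))
    (n := 1) (fun v => IsHomogeneous.sum _ _ _ fun s _ =>
      (homogeneousSubmodule _ ℂ 1).smul_mem _ (isHomogeneous_X _ _))
  rwa [one_mul] at this

theorem map_coordEquiv_symm_homogeneousSubmodule (m : ℕ) :
    (homogeneousSubmodule (Fin (n + 1)) ℂ m).map (coordEquiv e).symm.toLinearMap =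
      homogeneousSubmodule σ ℂ m := by
  ext F
  constructor
  · rintro ⟨G, hG, rfl⟩
    exact isHomogeneous_coordEquiv_symm e hG
  · intro hF
    exact ⟨coordEquiv e F, isHomogeneous_coordEquiv e hF, (coordEquiv e).symm_apply_apply F⟩

/-- The basis of `ℂⁿ⁺¹` dual to a basis of the space of linear forms. -/
noncomputable def pointBasis [DecidableEq σ] : Basis σ ℂ (Fin (n + 1) → ℂ) :=
  e.dualBasis.map (dotProductEquiv ℂ (Fin (n + 1))).symm

theorem pointBasis_repr [DecidableEq σ] (v : Fin (n + 1) → ℂ) (s : σ) :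
    (pointBasis e).repr v s = eval v (linForm (e s)) := by
  simp [pointBasis, eval_linForm, dotProduct_comm]

theorem eval_coordEquiv [DecidableEq σ] (v : Fin (n + 1) → ℂ) (F : MvPolynomial σ ℂ) :
    eval v (coordEquiv e F) = eval (fun s => (pointBasis e).repr v s) F := by
  have : ((aeval v).comp (coordEquiv e).toAlgHom : MvPolynomial σ ℂ →ₐ[ℂ] ℂ) =
      aeval (fun s => (pointBasis e).repr v s) := by
    ext1 s
    simp only [AlgHom.comp_apply, aeval_X, pointBasis_repr]
    exact congrArg (aeval v) (coordEquiv_X e s)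
  exact DFunLike.congr_fun this F

end LinearForms

/-! ### The ideal of minors of a pencil -/

section Pencil

variable {n : ℕ} {U : Type} [AddCommGroup U] [Module ℂ U]

/-- The ideal of the minors of the `2 × N` matrix of linear forms given by a pencil. -/
noncomputable def pencilIdeal (A B : U →ₗ[ℂ] (Fin (n + 1) → ℂ)) : Ideal (CoordRing n) :=
  Ideal.span {F | ∃ u u', F = linForm (A u) * linForm (B u') - linForm (A u') * linForm (B u)}

theorem minor_mem_pencilIdeal (A B : U →ₗ[ℂ] (Fin (n + 1) → ℂ)) (u u' : U) :
    linForm (A u) * linForm (B u') - linForm (A u') * linForm (B u) ∈ pencilIdeal A B :=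
  Ideal.subset_span ⟨u, u', rfl⟩

/-- If an ideal contains the minors of pairs of basis vectors, it contains all minors. -/
theorem pencilIdeal_le_of_basis {κ : Type*} (b : Basis κ ℂ U) {A B : U →ₗ[ℂ] (Fin (n + 1) → ℂ)}
    {J : Ideal (CoordRing n)}
    (h : ∀ k k', linForm (A (b k)) * linForm (B (b k')) -
      linForm (A (b k')) * linForm (B (b k)) ∈ J) :
    pencilIdeal A B ≤ J := by
  rw [pencilIdeal, Ideal.span_le]
  rintro _ ⟨u, u', rfl⟩
  rw [SetLike.mem_coe]
  induction b.mem_span u using Submodule.span_induction with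
  | mem _ hu =>
    obtain ⟨k, rfl⟩ := hu
    induction b.mem_span u' using Submodule.span_induction with
    | mem _ hu => obtain ⟨k', rfl⟩ := hu; exact h k k'
    | zero => simp
    | add x y _ _ hx hy =>
      convert J.add_mem hx hy using 1
      simp only [map_add]; ring
    | smul c x _ hx =>
      convert J.mul_mem_left (C c) hx using 1
      simp only [map_smul, smul_eq_C_mul]; ring
  | zero => simp
  | add x y _ _ hx hy =>
    convert J.add_mem hx hy using 1
    simp only [map_add]; ring
  | smul c x _ hx =>
    convert J.mul_mem_left (C c) hx using 1
    simp only [map_smul, smul_eq_C_mul]; ring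

variable {d : ℕ} {a : Fin d → ℕ} {A B : U →ₗ[ℂ] (Fin (n + 1) → ℂ)}
  {e : Basis (Σ i, Fin (a i + 1)) ℂ (Fin (n + 1) → ℂ)} {b : Basis (Σ i, Fin (a i)) ℂ U}

theorem pencilIdeal_eq_map (hl : ∀ i j, A (b ⟨i, j⟩) = e ⟨i, j.castSucc⟩)
    (hr : ∀ i j, B (b ⟨i, j⟩) = e ⟨i, j.succ⟩) :
    pencilIdeal A B = (scrollIdeal a).map (coordEquiv e) := by
  apply le_antisymm
  · refine pencilIdeal_le_of_basis b ?_
    rintro ⟨i, j⟩ ⟨i', j'⟩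
    rw [hl, hr, hl, hr]
    simp only [← coordEquiv_X, ← map_mul, ← map_sub]
    exact Ideal.mem_map_of_mem _ (Ideal.subset_span ⟨i, j, i', j', rfl⟩)
  · rw [scrollIdeal, Ideal.map_span, Ideal.span_le]
    rintro _ ⟨_, ⟨i, j, i', j', rfl⟩, rfl⟩
    simp only [map_sub, map_mul, coordEquiv_X, ← hl, ← hr]
    exact minor_mem_pencilIdeal A B _ _

theorem mem_pencilIdeal_iff (hl : ∀ i j, A (b ⟨i, j⟩) = e ⟨i, j.castSucc⟩)
    (hr : ∀ i j, B (b ⟨i, j⟩) = e ⟨i, j.succ⟩) (F : CoordRing n) :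
    F ∈ pencilIdeal A B ↔ scrollMap a ((coordEquiv e).symm F) = 0 := by
  rw [pencilIdeal_eq_map hl hr, ← RingHom.mem_ker, ker_scrollMap,
    Ideal.mem_map_of_equiv]
  constructor
  · rintro ⟨G, hG, rfl⟩
    rwa [AlgEquiv.symm_apply_apply]
  · intro h
    exact ⟨_, h, AlgEquiv.apply_symm_apply _ _⟩

/-- In Kronecker coordinates the ideal is the kernel of a homomorphism to a polynomial ring, which
is a domain. -/
theorem isPrime_pencilIdeal [FiniteDimensional ℂ U] (h : IsInjectivePencil A B) :
    (pencilIdeal A B).IsPrime := by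
  obtain ⟨d, a, e, b, hl, hr⟩ := h.exists_bases
  have : pencilIdeal A B = RingHom.ker ((scrollMap a).comp (coordEquiv e).symm.toAlgHom) := by
    ext F
    rw [mem_pencilIdeal_iff hl hr]
    rfl
  rw [this]
  exact RingHom.ker_isPrime _

theorem exists_pos_of_nontrivial [Nontrivial U] (b : Basis (Σ i, Fin (a i)) ℂ U) :
    ∃ i, 0 < a i := by
  obtain ⟨⟨i, j⟩⟩ := b.index_nonempty
  exact ⟨i, j.pos⟩

/-- The degree `m` part of the quotient is the image of the forms of degree `m` under the
parametrization. The sum of the `a i` is the dimension of `U`, by the Kronecker basis of `U`. -/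
theorem hasDegree_pencilIdeal [FiniteDimensional ℂ U] [Nontrivial U] (h : IsInjectivePencil A B) :
    HasDegree (pencilIdeal A B) (finrank ℂ U) := by
  obtain ⟨d, a, e, b, hl, hr⟩ := h.exists_bases
  obtain ⟨i, -⟩ := exists_pos_of_nontrivial b
  obtain ⟨c, rfl⟩ : ∃ c, d = c + 1 := ⟨d - 1, by have := i.pos; omega⟩
  refine HasDegree.of_hilbertFunction (e := c) finrank_pos.ne' fun m => ?_
  have hU : finrank ℂ U = ∑ i, a i := by
    rw [finrank_eq_card_basis b, Fintype.card_sigma]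
    simp
  rw [hU, ← finrank_map_scrollMap a (Fintype.card_fin _), hilbertFunction,
    ← map_coordEquiv_symm_homogeneousSubmodule e, ← Submodule.map_comp]
  let g := (((scrollMap a).toLinearMap ∘ₗ (coordEquiv e).symm.toLinearMap)).domRestrict
    (homogeneousSubmodule (Fin (n + 1)) ℂ m)
  have hker : ((pencilIdeal A B).restrictScalars ℂ).comap
      (homogeneousSubmodule (Fin (n + 1)) ℂ m).subtype = LinearMap.ker g := by
    ext F
    exact mem_pencilIdeal_iff hl hr F
  rw [hker, g.quotKerEquivRange.finrank_eq, LinearMap.range_domRestrict]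

end Pencil

/-! ### The scroll defined by a pencil -/

section Geometry

variable {n : ℕ}

/-- The relations say that the matrix with columns `(z_(i,j), z_(i,j+1))` has rank at most one. Any
nonzero column serves as `(s, t)`, and each block is then a geometric progression; if all columns
vanish, any `(s, t)` works. -/
theorem exists_scroll_parameters {d : ℕ} {a : Fin d → ℕ} {z : (Σ i, Fin (a i + 1)) → ℂ}
    (hz : ScrollRelations z) :
    ∃ s t : ℂ, (s ≠ 0 ∨ t ≠ 0) ∧ ∃ y : Fin d → ℂ, ∀ (i : Fin d) (j : Fin (a i + 1)),
      z ⟨i, j⟩ = y i * (s ^ (a i - (j : ℕ)) * t ^ (j : ℕ)) := by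
  have hst : ∃ s t : ℂ, (s ≠ 0 ∨ t ≠ 0) ∧
      ∀ (i : Fin d) (j : Fin (a i)), s * z ⟨i, j.succ⟩ = t * z ⟨i, j.castSucc⟩ := by
    by_cases h : ∃ (i : Fin d) (j : Fin (a i)), z ⟨i, j.castSucc⟩ ≠ 0 ∨ z ⟨i, j.succ⟩ ≠ 0
    · obtain ⟨i, j, hij⟩ := h
      refine ⟨_, _, hij, fun i' j' => ?_⟩
      rw [hz i j i' j', mul_comm]
    · push Not at h
      exact ⟨1, 0, by simp, fun i j => by rw [(h i j).2]; simp⟩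
  obtain ⟨s, t, h0, hst⟩ := hst
  refine ⟨s, t, h0, ?_⟩
  -- For `s = 0` only the last coordinate of each block survives and determines `y i`; otherwise the
  -- first coordinate does.
  by_cases hs : s = 0
  · subst hs
    have ht : t ≠ 0 := by simpa using h0
    refine ⟨fun i => z ⟨i, Fin.last _⟩ / t ^ a i, fun i j => ?_⟩
    induction j using Fin.lastCases with
    | last => simp [ht]
    | cast j =>
      have h1 : z ⟨i, j.castSucc⟩ = 0 := by simpa [ht] using (hst i j).symm
      have h2 : a i - (j.castSucc : ℕ) ≠ 0 := by
        have := j.2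
        rw [Fin.val_castSucc]
        omega
      rw [h1, zero_pow h2]
      simp
  · refine ⟨fun i => z ⟨i, 0⟩ / s ^ a i, fun i j => ?_⟩
    induction j using Fin.induction with
    | zero => simp [hs]
    | succ j ih =>
      have h1 := hst i j
      rw [ih, Fin.val_castSucc, show a i - (j : ℕ) = (a i - ((j : ℕ) + 1)) + 1 by omega] at h1
      rw [Fin.val_succ]
      refine mul_left_cancel₀ hs (h1.trans ?_)
      ring

theorem scrollRelations_of_parameters {d : ℕ} {a : Fin d → ℕ} {z : (Σ i, Fin (a i + 1)) → ℂ}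
    {s t : ℂ} {y : Fin d → ℂ}
    (h : ∀ (i : Fin d) (j : Fin (a i + 1)), z ⟨i, j⟩ = y i * (s ^ (a i - (j : ℕ)) * t ^ (j : ℕ))) :
    ScrollRelations z := by
  intro i j i' j'
  rw [h, h, h, h, Fin.val_castSucc, Fin.val_castSucc, Fin.val_succ, Fin.val_succ,
    show a i - (j : ℕ) = (a i - ((j : ℕ) + 1)) + 1 by omega,
    show a i' - (j' : ℕ) = (a i' - ((j' : ℕ) + 1)) + 1 by omega]
  ring

variable {d : ℕ} {a : Fin d → ℕ}

/-- The scroll with a given basis. -/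
def scrollSet (e : Basis (Σ i, Fin (a i + 1)) ℂ (Fin (n + 1) → ℂ)) : Set (ProjSpace n) :=
  {x | ∃ s t : ℂ, (s ≠ 0 ∨ t ≠ 0) ∧
      x.submodule ≤ Submodule.span ℂ (Set.range fun i : Fin d =>
        ∑ j : Fin (a i + 1), (s ^ (a i - (j : ℕ)) * t ^ (j : ℕ)) • e ⟨i, j⟩)}

theorem mem_scroll_span_iff (e : Basis (Σ i, Fin (a i + 1)) ℂ (Fin (n + 1) → ℂ)) (s t : ℂ)
    (v : Fin (n + 1) → ℂ) :
    v ∈ Submodule.span ℂ (Set.range fun i : Fin d =>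
        ∑ j : Fin (a i + 1), (s ^ (a i - (j : ℕ)) * t ^ (j : ℕ)) • e ⟨i, j⟩) ↔
      ∃ y : Fin d → ℂ, ∀ (i : Fin d) (j : Fin (a i + 1)),
        e.repr v ⟨i, j⟩ = y i * (s ^ (a i - (j : ℕ)) * t ^ (j : ℕ)) := by
  rw [Submodule.mem_span_range_iff_exists_fun]
  refine exists_congr fun y => ?_
  have h1 : (∑ i, y i • ∑ j : Fin (a i + 1), (s ^ (a i - (j : ℕ)) * t ^ (j : ℕ)) • e ⟨i, j⟩) =
      ∑ p : Σ i, Fin (a i + 1), (y p.1 * (s ^ (a p.1 - (p.2 : ℕ)) * t ^ (p.2 : ℕ))) • e p := by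
    rw [Fintype.sum_sigma]
    simp only [Finset.smul_sum, smul_smul]
  rw [h1]
  constructor
  · rintro rfl i j
    rw [e.repr_sum_self]
  · intro h
    conv_rhs => rw [← e.sum_repr v]
    refine Finset.sum_congr rfl fun p _ => ?_
    rw [← h p.1 p.2]

variable {U : Type} [AddCommGroup U] [Module ℂ U] {A B : U →ₗ[ℂ] (Fin (n + 1) → ℂ)}
  {e : Basis (Σ i, Fin (a i + 1)) ℂ (Fin (n + 1) → ℂ)} {b : Basis (Σ i, Fin (a i)) ℂ U}

theorem eval_pencilIdeal_iff (hl : ∀ i j, A (b ⟨i, j⟩) = e ⟨i, j.castSucc⟩)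
    (hr : ∀ i j, B (b ⟨i, j⟩) = e ⟨i, j.succ⟩) (v : Fin (n + 1) → ℂ) :
    (∀ F ∈ pencilIdeal A B, eval v F = 0) ↔
      ScrollRelations fun s => (pointBasis e).repr v s := by
  constructor
  · intro h i j i' j'
    have := h _ (minor_mem_pencilIdeal A B (b ⟨i, j⟩) (b ⟨i', j'⟩))
    rw [hl, hr, hl, hr, map_sub, map_mul, map_mul] at this
    simp only [pointBasis_repr]
    exact sub_eq_zero.1 this
  · intro h
    have : pencilIdeal A B ≤ RingHom.ker (eval v) := by
      refine pencilIdeal_le_of_basis b ?_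
      rintro ⟨i, j⟩ ⟨i', j'⟩
      rw [hl, hr, hl, hr, RingHom.mem_ker, map_sub, map_mul, map_mul]
      simp only [← pointBasis_repr]
      exact sub_eq_zero.2 (h i j i' j')
    exact fun F hF => this hF

theorem zeroLocus_pencilIdeal (hl : ∀ i j, A (b ⟨i, j⟩) = e ⟨i, j.castSucc⟩)
    (hr : ∀ i j, B (b ⟨i, j⟩) = e ⟨i, j.succ⟩) :
    zeroLocus (pencilIdeal A B : Set (CoordRing n)) = scrollSet (pointBasis e) := by
  ext x
  constructor
  · intro hx
    have hrep : x.rep ∈ x.submodule := by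
      rw [Projectivization.submodule_eq]; exact Submodule.mem_span_singleton_self _
    obtain ⟨s, t, h0, h⟩ := exists_scroll_parameters
      ((eval_pencilIdeal_iff hl hr x.rep).1 fun F hF => hx F hF _ hrep)
    refine ⟨s, t, h0, ?_⟩
    rw [Projectivization.submodule_eq, Submodule.span_singleton_le_iff_mem]
    exact (mem_scroll_span_iff _ _ _ _).2 h
  · rintro ⟨s, t, -, hx⟩ F hF v hv
    obtain ⟨y, hy⟩ := (mem_scroll_span_iff _ _ _ _).1 (hx hv)
    exact (eval_pencilIdeal_iff hl hr v).2 (scrollRelations_of_parameters hy) F hF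

/-- A polynomial vanishing on the scroll vanishes at all points with coordinates `t^j y_i`, so its
pullback is zero as a function on affine space, hence as a polynomial over the infinite field `ℂ`.
The chart `s = 1` suffices. -/
theorem vanishingIdeal_scrollSet [Nontrivial U] (hl : ∀ i j, A (b ⟨i, j⟩) = e ⟨i, j.castSucc⟩)
    (hr : ∀ i j, B (b ⟨i, j⟩) = e ⟨i, j.succ⟩) :
    vanishingIdeal (scrollSet (pointBasis e)) = pencilIdeal A B := by
  apply le_antisymm
  · intro F hF
    rw [mem_pencilIdeal_iff hl hr]
    have key : ∀ (v : Fin (n + 1) → ℂ) (t : ℂ) (y : Fin d → ℂ), (∀ (i : Fin d) (j : Fin (a i + 1)),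
        (pointBasis e).repr v ⟨i, j⟩ = y i * (1 ^ (a i - (j : ℕ)) * t ^ (j : ℕ))) → v ≠ 0 →
        ∃ x ∈ scrollSet (pointBasis e), v ∈ x.submodule := by
      intro v t y h hv
      refine ⟨Projectivization.mk ℂ v hv, ⟨1, t, by simp, ?_⟩, ?_⟩
      · rw [Projectivization.submodule_mk, Submodule.span_singleton_le_iff_mem]
        exact (mem_scroll_span_iff _ _ _ _).2 ⟨y, h⟩
      · rw [Projectivization.submodule_mk]
        exact Submodule.mem_span_singleton_self _
    -- The parameters may give the zero vector. It lies on every line, so one point of the scroll is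
    -- enough to get `F(0) = 0`.
    have hne : ∃ x, x ∈ scrollSet (pointBasis e) := by
      obtain ⟨i, -⟩ := exists_pos_of_nontrivial b
      obtain ⟨x, hx, -⟩ := key (pointBasis e ⟨i, 0⟩) 0 (fun i' => if i' = i then 1 else 0)
        (by
          intro i' j
          rw [Basis.repr_self, Finsupp.single_apply]
          by_cases h : i = i'
          · subst h
            by_cases hj : j = 0
            · simp [hj]
            · have : (j : ℕ) ≠ 0 := fun h => hj (Fin.ext h)
              simp [this, Ne.symm hj]
          · simp [h, Ne.symm h]) (Basis.ne_zero _ _)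
      exact ⟨x, hx⟩
    apply MvPolynomial.funext
    intro r
    let v : Fin (n + 1) → ℂ := ∑ p : Σ i, Fin (a i + 1),
      (r (some p.1) * (1 ^ (a p.1 - (p.2 : ℕ)) * r none ^ (p.2 : ℕ))) • pointBasis e p
    have hv : ∀ p, (pointBasis e).repr v p =
        r (some p.1) * (1 ^ (a p.1 - (p.2 : ℕ)) * r none ^ (p.2 : ℕ)) := fun p => by
      simp only [v]
      rw [Basis.repr_sum_self]
    have h1 : eval r (scrollMap a ((coordEquiv e).symm F)) = eval v F := by
      conv_rhs => rw [← (coordEquiv e).apply_symm_apply F, eval_coordEquiv]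
      have : ((aeval r).comp (scrollMap a) : _ →ₐ[ℂ] ℂ) =
          aeval fun s => (pointBasis e).repr v s := by
        ext1 p
        simp [scrollMap, hv, mul_comm]
      exact DFunLike.congr_fun this _
    rw [h1, map_zero]
    by_cases hv0 : v = 0
    · obtain ⟨x, hx⟩ := hne
      rw [hv0]
      exact hF x hx 0 (Submodule.zero_mem _)
    · obtain ⟨x, hx, hvx⟩ := key v (r none) (fun i => r (some i)) (fun i j => hv ⟨i, j⟩) hv0
      exact hF x hx v hvx
  · intro F hF x hx
    rw [← zeroLocus_pencilIdeal hl hr] at hx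
    exact hx F hF

theorem definesRationalNormalScroll_pencilIdeal [FiniteDimensional ℂ U] [Nontrivial U]
    (h : IsInjectivePencil A B) : DefinesRationalNormalScroll (pencilIdeal A B) := by
  obtain ⟨d, a, e, b, hl, hr⟩ := h.exists_bases
  exact ⟨scrollSet (pointBasis e), ⟨d, a, pointBasis e, exists_pos_of_nontrivial b, rfl⟩,
    zeroLocus_pencilIdeal hl hr, vanishingIdeal_scrollSet hl hr⟩

end Geometry

/-! ### The height of the ideal of minors -/

section Height

variable {n : ℕ}

/-- Evaluation at `ε` times the `w`-th unit vector, over the dual numbers, kills products of two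
linear forms and reads off the `w`-th coefficient of a single one. -/
theorem eq_zero_of_linForm_mem_pencilIdeal {U : Type} [AddCommGroup U] [Module ℂ U]
    {A B : U →ₗ[ℂ] (Fin (n + 1) → ℂ)} {c : Fin (n + 1) → ℂ} (hc : linForm c ∈ pencilIdeal A B) :
    c = 0 := by
  funext w
  let θ : CoordRing n →ₐ[ℂ] DualNumber ℂ :=
    aeval fun v => (Pi.single w 1 : Fin (n + 1) → ℂ) v • DualNumber.eps
  have hθ : ∀ c, θ (linForm c) = c w • DualNumber.eps := fun c => by
    simp [linForm_apply, θ, Pi.single_apply]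
  have hle : pencilIdeal A B ≤ RingHom.ker θ := by
    rw [pencilIdeal, Ideal.span_le]
    rintro _ ⟨u, u', rfl⟩
    simp [RingHom.mem_ker, hθ]
  have h := congrArg TrivSqZeroExt.snd ((hθ c).symm.trans (RingHom.mem_ker.1 (hle hc)))
  simpa using h

theorem exists_dotProduct_ne_zero {S : Submodule ℂ (Fin (n + 1) → ℂ)} {c : Fin (n + 1) → ℂ}
    (hc : c ∉ S) : ∃ v, (∀ x ∈ S, x ⬝ᵥ v = 0) ∧ c ⬝ᵥ v ≠ 0 := by
  obtain ⟨φ, hφ, hS⟩ := Submodule.exists_le_ker_of_notMem hc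
  refine ⟨(dotProductEquiv ℂ _).symm φ, fun x hx => ?_, ?_⟩
  · have : (dotProductEquiv ℂ _ ((dotProductEquiv ℂ _).symm φ)) x = 0 := by
      rw [LinearEquiv.apply_symm_apply]; exact hS hx
    rwa [dotProductEquiv_apply_apply, dotProduct_comm] at this
  · have : (dotProductEquiv ℂ _ ((dotProductEquiv ℂ _).symm φ)) c ≠ 0 := by
      rw [LinearEquiv.apply_symm_apply]; exact hφ
    rwa [dotProductEquiv_apply_apply, dotProduct_comm] at this

variable {U : Type} [AddCommGroup U] [Module ℂ U]
  {A B : U →ₗ[ℂ] (Fin (n + 1) → ℂ)}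

theorem pencilIdeal_domRestrict_le (W : Submodule ℂ U) :
    pencilIdeal (A.domRestrict W) (B.domRestrict W) ≤ pencilIdeal A B := by
  rw [pencilIdeal, Ideal.span_le]
  rintro _ ⟨u, u', rfl⟩
  exact minor_mem_pencilIdeal A B _ _

variable [FiniteDimensional ℂ U]

/-- On the linear space where `A(W)` vanishes, all minors of the restricted pencil vanish, while the
minor of `u ∉ W` and `w ∈ W` becomes `A(u)B(w)`. Here `A(u)` is not identically zero since `A` is
injective, and neither is `B(w)` for a suitable `w`, by `not_range_le` on `W`. -/
theorem pencilIdeal_domRestrict_lt (h : IsInjectivePencil A B) (W : Submodule ℂ U) [Nontrivial W]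
    (hW : W ≠ ⊤) : pencilIdeal (A.domRestrict W) (B.domRestrict W) < pencilIdeal A B := by
  refine lt_of_le_of_ne (pencilIdeal_domRestrict_le W) fun heq => ?_
  obtain ⟨u, hu⟩ : ∃ u, u ∉ W := by
    by_contra! hcon
    exact hW (eq_top_iff.2 fun x _ => hcon x)
  have hAu : A u ∉ W.map A := by
    rintro ⟨w, hw, hwu⟩
    exact hu (h.injective_left hwu ▸ hw)
  obtain ⟨v₀, hv₀, hAv₀⟩ := exists_dotProduct_ne_zero hAu
  have key : ∀ v, (∀ x ∈ W.map A, x ⬝ᵥ v = 0) → ∀ w ∈ W, (A u ⬝ᵥ v) * (B w ⬝ᵥ v) = 0 := by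
    intro v hv w hw
    have h1 : pencilIdeal (A.domRestrict W) (B.domRestrict W) ≤ RingHom.ker (eval v) := by
      rw [pencilIdeal, Ideal.span_le]
      rintro _ ⟨x, y, rfl⟩
      rw [SetLike.mem_coe, RingHom.mem_ker, map_sub, map_mul, map_mul]
      simp [eval_linForm, hv _ ⟨x, x.2, rfl⟩, hv _ ⟨y, y.2, rfl⟩]
    have h2 := h1 (heq ▸ minor_mem_pencilIdeal A B u w)
    rw [RingHom.mem_ker, map_sub, map_mul, map_mul] at h2
    simpa [eval_linForm, hv _ ⟨w, hw, rfl⟩] using h2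
  refine (h.domRestrict W).not_range_le ?_
  rintro _ ⟨⟨w, hw⟩, rfl⟩
  rw [LinearMap.range_domRestrict, LinearMap.domRestrict_apply]
  by_contra hB
  obtain ⟨v, hv, hBv⟩ := exists_dotProduct_ne_zero hB
  have h1 : A u ⬝ᵥ v = 0 := by simpa [hBv] using key v hv w hw
  have h2 : B w ⬝ᵥ v₀ = 0 := by simpa [hAv₀] using key v₀ hv₀ w hw
  -- With `A u` vanishing at `v` and `B w` at `v₀`, the product is nonzero at `v + v₀`.
  have h3 := key (v + v₀) (fun x hx => by rw [dotProduct_add, hv x hx, hv₀ x hx, add_zero]) w hw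
  rw [dotProduct_add, dotProduct_add, h1, h2, zero_add, add_zero] at h3
  exact (mul_ne_zero hAv₀ hBv) h3

/-- A flag of subspaces of `U` of dimensions `1, …, k + 1` yields a strictly increasing chain of `k
+ 1` prime ideals. -/
theorem le_height_pencilIdeal : ∀ (k : ℕ) {U : Type} [AddCommGroup U] [Module ℂ U]
    [FiniteDimensional ℂ U] {A B : U →ₗ[ℂ] (Fin (n + 1) → ℂ)}, IsInjectivePencil A B →
    finrank ℂ U = k + 1 → (k : ℕ∞) ≤ (pencilIdeal A B).height
  | 0, _, _, _, _, _, _, _, _ => by simp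
  | k + 1, U, _, _, _, A, B, h, hU => by
    let b := finBasisOfFinrankEq ℂ U hU
    let W : Submodule ℂ U := Submodule.span ℂ (Set.range (b ∘ Fin.castSucc))
    have hW : finrank ℂ W = k + 1 := by
      rw [finrank_span_eq_card (b.linearIndependent.comp _ (Fin.castSucc_injective _)),
        Fintype.card_fin]
    have : Nontrivial W := nontrivial_of_finrank_pos (R := ℂ) (by omega)
    have hlt := pencilIdeal_domRestrict_lt h W (by
      intro hW'
      rw [hW', finrank_top] at hW
      omega)
    have := isPrime_pencilIdeal h
    have := isPrime_pencilIdeal (h.domRestrict W)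
    have h1 := le_height_pencilIdeal k (h.domRestrict W) hW
    have h2 := Ideal.height_add_one_le_of_lt_of_isPrime hlt
    push_cast
    exact (add_le_add_left h1 1).trans h2

/-- By Krull's theorem it suffices that the ideal is minimal over the `k` minors involving the first
column. A prime between them contains `A(b 0)` times every minor, but not `A(b 0)`, since the pencil
ideal contains no nonzero linear form. -/
theorem height_pencilIdeal_le (h : IsInjectivePencil A B) {k : ℕ} (hU : finrank ℂ U = k + 1) :
    (pencilIdeal A B).height ≤ k := by
  classical
  let b := finBasisOfFinrankEq ℂ U hU
  have hprime := isPrime_pencilIdeal h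
  let q : Fin k → CoordRing n := fun i =>
    linForm (A (b 0)) * linForm (B (b i.succ)) - linForm (A (b i.succ)) * linForm (B (b 0))
  have hmin : pencilIdeal A B ∈ (Ideal.span (Set.range q)).minimalPrimes := by
    refine ⟨⟨hprime, ?_⟩, ?_⟩
    · rw [Ideal.span_le]
      rintro _ ⟨i, rfl⟩
      exact minor_mem_pencilIdeal A B _ _
    · rintro P ⟨hP, hle⟩ hPJ
      have hq : ∀ i : Fin (k + 1), linForm (A (b 0)) * linForm (B (b i)) -
          linForm (A (b i)) * linForm (B (b 0)) ∈ P := by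
        intro i
        induction i using Fin.cases with
        | zero => simp
        | succ i => exact hle (Ideal.subset_span ⟨i, rfl⟩)
      refine pencilIdeal_le_of_basis b fun i j => ?_
      have h1 : linForm (A (b 0)) * (linForm (A (b i)) * linForm (B (b j)) -
          linForm (A (b j)) * linForm (B (b i))) ∈ P := by
        convert P.sub_mem (P.mul_mem_left (linForm (A (b i))) (hq j))
          (P.mul_mem_left (linForm (A (b j))) (hq i)) using 1
        ring
      refine (hP.mem_or_mem h1).resolve_left fun h2 => ?_
      refine b.ne_zero 0 (h.injective_left ?_)
      rw [eq_zero_of_linForm_mem_pencilIdeal (hPJ h2), map_zero]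
  refine (Ideal.height_le_card_of_mem_minimalPrimes_span (Set.finite_range q) hmin).trans ?_
  norm_cast
  rw [← Set.image_univ]
  exact (Set.ncard_image_le Set.finite_univ).trans (by rw [Set.ncard_univ]; simp)

theorem height_pencilIdeal (h : IsInjectivePencil A B) {k : ℕ} (hU : finrank ℂ U = k + 1) :
    (pencilIdeal A B).height = k :=
  le_antisymm (height_pencilIdeal_le h hU) (le_height_pencilIdeal k h hU)

end Height

/-! ### Forms of low degree in the ideal of a non-degenerate variety -/

section Vanishing

variable {n : ℕ} {X : Set (ProjSpace n)}

theorem vanishesAt_linForm_iff {c : Fin (n + 1) → ℂ} {x : ProjSpace n} :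
    VanishesAt (linForm c) x ↔ eval x.rep (linForm c) = 0 := by
  constructor
  · intro h
    refine h _ ?_
    rw [Projectivization.submodule_eq]
    exact Submodule.mem_span_singleton_self _
  · intro h v hv
    rw [Projectivization.submodule_eq] at hv
    obtain ⟨r, rfl⟩ := Submodule.mem_span_singleton.1 hv
    rw [eval_linForm] at h ⊢
    rw [dotProduct_smul, h, smul_zero]

theorem IsNondegenerate.eq_zero_of_linForm_mem (hX : IsNondegenerate X) {c : Fin (n + 1) → ℂ}
    (hc : linForm c ∈ vanishingIdeal X) : c = 0 := by
  have h := hX (LinearMap.ker (dotProductEquiv ℂ _ c)) fun x hx v hv => by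
    rw [LinearMap.mem_ker, dotProductEquiv_apply_apply, ← eval_linForm]
    exact hc x hx v hv
  rw [LinearMap.ker_eq_top] at h
  exact (LinearEquiv.map_eq_zero_iff _).1 h

theorem IsIrreducibleVariety.linForm_mem_or_mem (hX : IsIrreducibleVariety X)
    {c c' : Fin (n + 1) → ℂ} (h : linForm c * linForm c' ∈ vanishingIdeal X) :
    linForm c ∈ vanishingIdeal X ∨ linForm c' ∈ vanishingIdeal X := by
  have hsub : X ⊆ zeroLocus {linForm c} ∪ zeroLocus {linForm c'} := by
    intro x hx
    have h1 := h x hx x.rep (by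
      rw [Projectivization.submodule_eq]; exact Submodule.mem_span_singleton_self _)
    rw [map_mul, mul_eq_zero] at h1
    refine h1.imp ?_ ?_ <;>
    · rintro h2 F rfl
      exact vanishesAt_linForm_iff.2 h2
  refine (hX.irreducible _ _ ⟨_, rfl⟩ ⟨_, rfl⟩ hsub).imp ?_ ?_ <;>
  · intro h1 x hx
    exact h1 hx _ rfl

theorem two_le_of_mem_vanishingIdeal (hne : X.Nonempty) (hX : IsNondegenerate X) {F : CoordRing n}
    {m : ℕ} (hF : F ∈ vanishingIdeal X) (hm : F.IsHomogeneous m) (h0 : F ≠ 0) : 2 ≤ m := by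
  by_contra! hlt
  obtain rfl | rfl : m = 0 ∨ m = 1 := by omega
  · obtain ⟨x, hx⟩ := hne
    have h1 := hF x hx 0 (Submodule.zero_mem _)
    rw [← totalDegree_zero_iff_isHomogeneous, totalDegree_eq_zero_iff_eq_C] at hm
    rw [hm, eval_C] at h1
    exact h0 (by rw [hm, h1, C_0])
  · obtain ⟨c, rfl⟩ := exists_linForm_eq hm
    exact h0 (by rw [hX.eq_zero_of_linForm_mem hF, map_zero])

end Vanishing

/-! ### The linear strand of a minimal resolution -/

section ConstVec

variable {n r : ℕ}

/-- A vector of constants as a vector of polynomials. -/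
noncomputable def constVec : (Fin r → ℂ) →ₗ[ℂ] (Fin r → CoordRing n) where
  toFun c l := C (c l)
  map_add' _ _ := by ext1; simp
  map_smul' _ _ := by ext1; simp [smul_eq_C_mul]

theorem constVec_apply (c : Fin r → ℂ) (l : Fin r) :
    (constVec c : Fin r → CoordRing n) l = C (c l) := rfl

theorem constVec_single (k : Fin r) :
    (constVec (Pi.single k 1) : Fin r → CoordRing n) = Pi.single k 1 := by
  funext l
  rw [constVec_apply, Pi.single_apply, Pi.single_apply]
  split_ifs <;> simp

/-- The vector of the coefficients of a monomial in a vector of polynomials. -/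
noncomputable def coeffVec (m : Fin (n + 1) →₀ ℕ) :
    (Fin r → CoordRing n) →ₗ[ℂ] (Fin r → CoordRing n) where
  toFun y := constVec fun l => coeff m (y l)
  map_add' _ _ := by ext1; simp [constVec_apply]
  map_smul' _ _ := by ext1; simp [constVec_apply, smul_eq_C_mul]

theorem coeffVec_apply (m : Fin (n + 1) →₀ ℕ) (y : Fin r → CoordRing n) (l : Fin r) :
    coeffVec m y l = C (coeff m (y l)) := rfl

theorem coeffVec_smul_constVec (m : Fin (n + 1) →₀ ℕ) (F : CoordRing n) (c : Fin r → ℂ) :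
    coeffVec m (F • constVec c) = coeff m F • (constVec c : Fin r → CoordRing n) := by
  funext l
  rw [coeffVec_apply, Pi.smul_apply, Pi.smul_apply, constVec_apply, smul_eq_mul, mul_comm,
    coeff_C_mul, smul_eq_C_mul, C_mul, mul_comm]

end ConstVec

namespace MinimalResolution

variable {n : ℕ} {I : Ideal (CoordRing n)} (P : MinimalResolution I)

theorem mem_linSyz_iff {i : ℕ} {w : P.Mod i} :
    w ∈ P.linSyz i ↔ ∃ c, (∀ l, c l ≠ 0 → P.deg i l = i + 2) ∧ constVec c = w := by
  constructor
  · intro hw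
    refine Submodule.span_induction ?_ ?_ ?_ ?_ hw
    · rintro _ ⟨k, hk, rfl⟩
      refine ⟨Pi.single k 1, fun l hl => ?_, constVec_single k⟩
      obtain rfl : l = k := by
        by_contra h
        exact hl (Pi.single_eq_of_ne h _)
      exact hk
    · exact ⟨0, fun l hl => absurd rfl hl, map_zero _⟩
    · rintro _ _ - - ⟨c, hc, rfl⟩ ⟨c', hc', rfl⟩
      refine ⟨c + c', fun l hl => ?_, map_add _ _ _⟩
      by_cases h : c l = 0
      · exact hc' l fun h' => hl (by simp [h, h'])
      · exact hc l h
    · rintro r _ - ⟨c, hc, rfl⟩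
      exact ⟨r • c, fun l hl => hc l fun h => hl (by simp [h]), map_smul _ _ _⟩
  · rintro ⟨c, hc, rfl⟩
    rw [pi_eq_sum_univ' c, map_sum]
    refine Submodule.sum_mem _ fun k _ => ?_
    rw [map_smul]
    by_cases h : c k = 0
    · rw [h, zero_smul]; exact Submodule.zero_mem _
    · refine Submodule.smul_mem _ _ (Submodule.subset_span ⟨k, hc k h, ?_⟩)
      rw [← constVec_single]

theorem coeffVec_smul {i : ℕ} (m : Fin (n + 1) →₀ ℕ) (F : CoordRing n) {w : P.Mod i}
    (hw : w ∈ P.linSyz i) : coeffVec m (F • w) = coeff m F • w := by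
  obtain ⟨c, -, rfl⟩ := P.mem_linSyz_iff.1 hw
  exact coeffVec_smul_constVec m F c

theorem eq_zero_of_sum_X_smul {i : ℕ} {w : Fin (n + 1) → P.Mod i} (hw : ∀ v, w v ∈ P.linSyz i)
    (h : ∑ v, (X v : CoordRing n) • w v = 0) (u : Fin (n + 1)) : w u = 0 := by
  have h1 := congrArg (coeffVec (Finsupp.single u 1)) h
  rw [map_sum, map_zero, Finset.sum_eq_single u] at h1
  · rwa [P.coeffVec_smul _ _ (hw u), coeff_X, if_pos rfl, one_smul] at h1
  · intro v _ hv
    rw [P.coeffVec_smul _ _ (hw v), coeff_X, if_neg (by simpa [Finsupp.single_left_inj] using hv),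
      zero_smul]
  · simp

/-- Since the `w u v` are constant vectors, the coefficient of `x_u x_v` can be compared: it is `w u
v + w v u` for `u ≠ v`, and `w u u` for `u = v`. -/
theorem add_eq_zero_of_sum_X_smul {i : ℕ} {w : Fin (n + 1) → Fin (n + 1) → P.Mod i}
    (hw : ∀ u v, w u v ∈ P.linSyz i)
    (h : ∑ u, ∑ v, ((X u : CoordRing n) * X v) • w u v = 0) (u v : Fin (n + 1)) :
    w u v + w v u = 0 := by
  have h1 := congrArg (coeffVec (Finsupp.single u 1 + Finsupp.single v 1)) h
  simp only [map_sum, map_zero, P.coeffVec_smul _ _ (hw _ _)] at h1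
  have h2 : ∀ u' v', coeff (Finsupp.single u 1 + Finsupp.single v 1)
      ((X u' : CoordRing n) * X v') = if (u' = u ∧ v' = v) ∨ (u' = v ∧ v' = u) then 1 else 0 := by
    intro u' v'
    rw [X, X, monomial_mul, coeff_monomial, mul_one]
    refine if_congr ?_ rfl rfl
    rw [Finsupp.single_add_single_eq_single_add_single one_ne_zero one_ne_zero]
    simp
  simp only [h2] at h1
  by_cases huv : u = v
  · subst huv
    simp only [or_self, ite_and, ite_smul, one_smul, zero_smul, Finset.sum_ite_irrel,
      Finset.sum_ite_eq', Finset.mem_univ, if_true, Finset.sum_const_zero] at h1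
    rw [h1, add_zero]
  · have h3 : ∀ u' v', (if (u' = u ∧ v' = v) ∨ (u' = v ∧ v' = u) then (1 : ℂ) else 0) =
        (if u' = u then if v' = v then 1 else 0 else 0) +
          if u' = v then if v' = u then 1 else 0 else 0 := by
      intro u' v'
      by_cases h4 : u' = u
      · subst h4
        simp [huv]
      · simp [h4, ite_and]
    simp only [h3, add_smul, Finset.sum_add_distrib, ite_smul, one_smul, zero_smul,
      Finset.sum_ite_irrel, Finset.sum_ite_eq', Finset.mem_univ, if_true,
      Finset.sum_const_zero] at h1
    exact h1

/-- The differential has entries without constant terms. -/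
theorem constantCoeff_d {i : ℕ} (y : P.Mod (i + 1)) (l : Fin (P.rk i)) :
    constantCoeff (P.d i y l) = 0 := by
  rw [pi_eq_sum_univ' y, map_sum, Finset.sum_apply, map_sum]
  refine Finset.sum_eq_zero fun k _ => ?_
  rw [map_smul, Pi.smul_apply, smul_eq_mul, map_mul]
  rw [P.minimal i k l, mul_zero]

/-- The kernel of `d` is the image of the next differential, whose values have no constant terms by
minimality. -/
theorem eq_zero_of_d_constVec {i : ℕ} {c : Fin (P.rk (i + 1)) → ℂ}
    (h : P.d i (constVec c) = 0) : c = 0 := by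
  obtain ⟨z, hz⟩ := (P.exact_succ i _).1 h
  funext l
  have := P.constantCoeff_d z l
  rwa [hz, constVec_apply, constantCoeff_C] at this

theorem eq_zero_of_ε_constVec {c : Fin (P.rk 0) → ℂ} (h : P.ε (constVec c) = 0) : c = 0 := by
  obtain ⟨z, hz⟩ := (P.exact_zero _).1 h
  funext l
  have := P.constantCoeff_d z l
  rwa [hz, constVec_apply, constantCoeff_C] at this

theorem eq_zero_of_d {i : ℕ} {w : P.Mod (i + 1)} (hw : w ∈ P.linSyz (i + 1)) (h : P.d i w = 0) :
    w = 0 := by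
  obtain ⟨c, -, rfl⟩ := P.mem_linSyz_iff.1 hw
  rw [P.eq_zero_of_d_constVec h, map_zero]

theorem eq_zero_of_ε {w : P.Mod 0} (hw : w ∈ P.linSyz 0) (h : P.ε w = 0) : w = 0 := by
  obtain ⟨c, -, rfl⟩ := P.mem_linSyz_iff.1 hw
  rw [P.eq_zero_of_ε_constVec h, map_zero]

theorem ε_mem (w : P.Mod 0) : P.ε w ∈ I :=
  P.range_ε.le ⟨w, rfl⟩

theorem isHomogeneous_ε {w : P.Mod 0} (hw : w ∈ P.linSyz 0) : (P.ε w).IsHomogeneous 2 := by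
  refine Submodule.span_induction (p := fun w _ => (P.ε w).IsHomogeneous 2) ?_ ?_ ?_ ?_ hw
  · rintro _ ⟨k, hk, rfl⟩
    simpa [hk] using P.ε_homogeneous k
  · rw [map_zero]; exact isHomogeneous_zero _ _ _
  · intro x y _ _ hx hy
    rw [map_add]; exact hx.add hy
  · intro r x _ hx
    rw [LinearMap.map_smul_of_tower]
    exact (homogeneousSubmodule _ ℂ 2).smul_mem _ hx

/-- The generators of the `i`-th module have degree at least `i + 2` if the ideal contains no forms
of degree less than two. -/
theorem add_two_le_deg (hI : ∀ F ∈ I, ∀ m, F.IsHomogeneous m → F ≠ 0 → 2 ≤ m) :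
    ∀ i k, i + 2 ≤ P.deg i k
  | 0, k => by
    rw [zero_add]
    refine hI _ (P.ε_mem _) _ (P.ε_homogeneous k) fun h => ?_
    rw [← constVec_single] at h
    have := congrFun (P.eq_zero_of_ε_constVec h) k
    simp at this
  | i + 1, k => by
    have h : P.d i (Pi.single k 1) ≠ 0 := fun h => by
      rw [← constVec_single] at h
      have := congrFun (P.eq_zero_of_d_constVec h) k
      simp at this
    obtain ⟨l, hl⟩ := Function.ne_iff.1 h
    obtain ⟨m, hm⟩ := support_nonempty.2 hl
    have h1 := P.d_homogeneous i k l m hm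
    have h2 := add_two_le_deg hI i l
    have h3 : m.degree ≠ 0 := fun h0 => by
      rw [Finsupp.degree_eq_zero_iff] at h0
      subst h0
      exact mem_support_iff.1 hm (P.minimal i k l)
    omega

/-- The coefficient of a variable in the differential of the linear strand. -/
noncomputable def diffCoeff (i : ℕ) (v : Fin (n + 1)) : P.Mod (i + 1) →ₗ[ℂ] P.Mod i :=
  coeffVec (Finsupp.single v 1) ∘ₗ (P.d i).restrictScalars ℂ

theorem diffCoeff_apply (i : ℕ) (v : Fin (n + 1)) (w : P.Mod (i + 1)) :
    P.diffCoeff i v w = coeffVec (Finsupp.single v 1) (P.d i w) := rfl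

variable (hI : ∀ F ∈ I, ∀ m, F.IsHomogeneous m → F ≠ 0 → 2 ≤ m)

-- Generators of the `i`-th module have degree at least `i + 2` and nonzero entries have positive
-- degree, so a column of degree `i + 3` leaves no slack.
include hI in
theorem d_single {i : ℕ} {k : Fin (P.rk (i + 1))} (hk : P.deg (i + 1) k = i + 1 + 2)
    (l : Fin (P.rk i)) : (P.d i (Pi.single k 1) l).IsHomogeneous 1 ∧
      (P.d i (Pi.single k 1) l ≠ 0 → P.deg i l = i + 2) := by
  have h : ∀ m ∈ (P.d i (Pi.single k 1) l).support, m.degree = 1 ∧ P.deg i l = i + 2 := by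
    intro m hm
    have h1 := P.d_homogeneous i k l m hm
    have h2 := P.add_two_le_deg hI i l
    have h3 : m.degree ≠ 0 := fun h0 => by
      rw [Finsupp.degree_eq_zero_iff] at h0
      subst h0
      exact mem_support_iff.1 hm (P.minimal i k l)
    omega
  constructor
  · intro m hm
    have := (h m (mem_support_iff.2 hm)).1
    rwa [Finsupp.degree_eq_weight_one] at this
  · intro h0
    obtain ⟨m, hm⟩ := support_nonempty.2 h0
    exact (h m hm).2

include hI in
theorem diffCoeff_mem {i : ℕ} (v : Fin (n + 1)) {w : P.Mod (i + 1)} (hw : w ∈ P.linSyz (i + 1)) :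
    P.diffCoeff i v w ∈ P.linSyz i := by
  have : P.linSyz (i + 1) ≤ (P.linSyz i).comap (P.diffCoeff i v) := by
    rw [linSyz, Submodule.span_le]
    rintro _ ⟨k, hk, rfl⟩
    refine P.mem_linSyz_iff.2 ⟨fun l => coeff (Finsupp.single v 1) (P.d i (Pi.single k 1) l),
      fun l hl => (P.d_single hI hk l).2 fun h => hl ?_, rfl⟩
    change coeff _ (P.d i (Pi.single k 1) l) = 0
    rw [h, coeff_zero]
  exact this hw

include hI in
theorem d_eq_sum {i : ℕ} {w : P.Mod (i + 1)} (hw : w ∈ P.linSyz (i + 1)) :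
    P.d i w = ∑ v, (X v : CoordRing n) • P.diffCoeff i v w := by
  refine Submodule.span_induction
    (p := fun w _ => P.d i w = ∑ v, (X v : CoordRing n) • P.diffCoeff i v w) ?_ ?_ ?_ ?_ hw
  · rintro _ ⟨k, hk, rfl⟩
    funext l
    obtain ⟨c, hc⟩ := exists_linForm_eq (P.d_single hI hk l).1
    rw [← hc, linForm_apply, Finset.sum_apply]
    refine Finset.sum_congr rfl fun v _ => ?_
    rw [Pi.smul_apply, diffCoeff_apply, coeffVec_apply, ← hc, coeff_linForm, smul_eq_mul,
      smul_eq_C_mul, mul_comm]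
  · simp
  · intro x y _ _ hx hy
    rw [map_add, hx, hy, ← Finset.sum_add_distrib]
    exact Finset.sum_congr rfl fun v _ => by rw [map_add, smul_add]
  · intro r x _ hx
    rw [LinearMap.map_smul_of_tower, hx, Finset.smul_sum]
    exact Finset.sum_congr rfl fun v _ => by rw [map_smul, smul_comm]

-- Taking the coefficients of a monomial carries the `R`-span of a space `W` of linear syzygies back
-- into `W`. Any admissible `W` therefore contains the coefficients of `d f`.
include hI in
theorem involved_eq {q : ℕ} {f : P.Mod (q + 1)} (hf : f ∈ P.linSyz (q + 1)) :
    P.involved f = Submodule.span ℂ (Set.range fun v => P.diffCoeff q v f) := by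
  apply le_antisymm
  · refine sInf_le ⟨?_, ?_⟩
    · rw [Submodule.span_le]
      rintro _ ⟨v, rfl⟩
      exact P.diffCoeff_mem hI v hf
    · rw [P.d_eq_sum hI hf]
      exact Submodule.sum_mem _ fun v _ => Submodule.smul_mem _ _
        (Submodule.subset_span (Submodule.subset_span ⟨v, rfl⟩))
  · refine le_sInf ?_
    rintro W ⟨hW, hdf⟩
    rw [Submodule.span_le]
    rintro _ ⟨v, rfl⟩
    have : ∀ y ∈ Submodule.span (CoordRing n) (W : Set (P.Mod q)),
        ∀ m, coeffVec m y ∈ W := by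
      intro y hy m
      refine Submodule.closure_induction (p := fun y _ => coeffVec m y ∈ W) ?_ ?_ ?_ hy
      · rw [map_zero]; exact W.zero_mem
      · intro x y _ _ hx hy
        rw [map_add]; exact W.add_mem hx hy
      · intro r x hx
        rw [P.coeffVec_smul m r (hW hx)]
        exact W.smul_mem _ hx
    exact this _ hdf _

end MinimalResolution

/-! ### Contractions on the exterior algebra -/

section Exterior

variable {K M : Type*} [Field K] [AddCommGroup M] [Module K M]

/-- Contraction of an element of the exterior algebra with a linear form. -/
noncomputable def contract (l : Dual K M) : ExteriorAlgebra K M →ₗ[K] ExteriorAlgebra K M :=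
  CliffordAlgebra.contractLeft l

theorem contract_ι_mul (l : Dual K M) (x : M) (w : ExteriorAlgebra K M) :
    contract l (ExteriorAlgebra.ι K x * w) = l x • w - ExteriorAlgebra.ι K x * contract l w :=
  CliffordAlgebra.contractLeft_ι_mul l x w

theorem contract_contract (l : Dual K M) (w : ExteriorAlgebra K M) :
    contract l (contract l w) = 0 :=
  CliffordAlgebra.contractLeft_contractLeft l w

theorem contract_add (l l' : Dual K M) (w : ExteriorAlgebra K M) :
    contract (l + l') w = contract l w + contract l' w := by
  simp [contract]

theorem contract_smul (c : K) (l : Dual K M) (w : ExteriorAlgebra K M) :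
    contract (c • l) w = c • contract l w := by
  simp [contract]

theorem ι_mul_mem {j : ℕ} (x : M) {w : ExteriorAlgebra K M} (hw : w ∈ ⋀[K]^j M) :
    ExteriorAlgebra.ι K x * w ∈ ⋀[K]^(j + 1) M := by
  rw [ExteriorAlgebra.exteriorPower, pow_succ']
  exact Submodule.mul_mem_mul ⟨x, rfl⟩ hw

theorem exists_smul_one_of_mem {w : ExteriorAlgebra K M} (hw : w ∈ ⋀[K]^0 M) :
    ∃ c : K, w = c • 1 := by
  rw [ExteriorAlgebra.exteriorPower, pow_zero, Submodule.mem_one] at hw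
  obtain ⟨c, rfl⟩ := hw
  exact ⟨c, Algebra.algebraMap_eq_smul_one c⟩

theorem one_mem_exteriorPower_zero : (1 : ExteriorAlgebra K M) ∈ ⋀[K]^0 M := by
  rw [ExteriorAlgebra.exteriorPower, pow_zero]
  exact Submodule.one_le.1 le_rfl

theorem contract_of_mem_zero (l : Dual K M) {w : ExteriorAlgebra K M} (hw : w ∈ ⋀[K]^0 M) :
    contract l w = 0 := by
  obtain ⟨c, rfl⟩ := exists_smul_one_of_mem hw
  rw [map_smul, contract, CliffordAlgebra.contractLeft_one, smul_zero]

/-- Induction on the degree of an element of an exterior power. -/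
theorem exteriorPower_succ_induction {j : ℕ} {p : ExteriorAlgebra K M → Prop}
    (hι : ∀ x : M, ∀ w ∈ ⋀[K]^j M, p (ExteriorAlgebra.ι K x * w))
    (hadd : ∀ w w', p w → p w' → p (w + w')) {w : ExteriorAlgebra K M}
    (hw : w ∈ ⋀[K]^(j + 1) M) : p w := by
  rw [ExteriorAlgebra.exteriorPower, pow_succ'] at hw
  refine Submodule.mul_induction_on hw ?_ hadd
  rintro _ ⟨x, rfl⟩ w hw
  exact hι x w hw

theorem contract_mem (l : Dual K M) : ∀ {j : ℕ} {w : ExteriorAlgebra K M},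
    w ∈ ⋀[K]^(j + 1) M → contract l w ∈ ⋀[K]^j M
  | 0, w, hw => by
    refine exteriorPower_succ_induction (p := fun w => contract l w ∈ ⋀[K]^0 M)
      (fun x w hw => ?_) (fun w w' h h' => ?_) hw
    · rw [contract_ι_mul, contract_of_mem_zero l hw, mul_zero, sub_zero]
      exact Submodule.smul_mem _ _ hw
    · rw [map_add]; exact Submodule.add_mem _ h h'
  | j + 1, w, hw => by
    refine exteriorPower_succ_induction (p := fun w => contract l w ∈ ⋀[K]^(j + 1) M)
      (fun x w hw => ?_) (fun w w' h h' => ?_) hw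
    · rw [contract_ι_mul]
      exact Submodule.sub_mem _ (Submodule.smul_mem _ _ hw) (ι_mul_mem x (contract_mem l hw))
    · rw [map_add]; exact Submodule.add_mem _ h h'

variable {κ : Type*} [Fintype κ] {g : κ → M} {τ : κ → Dual K M}

/-- Euler's identity for the exterior algebra. The `g v` need not be independent: only the
resolution of the identity by `g` and `τ` is used. -/
theorem sum_ι_mul_contract (h : ∀ x, ∑ v, τ v x • g v = x) :
    ∀ {j : ℕ} {w : ExteriorAlgebra K M}, w ∈ ⋀[K]^j M →
      ∑ v, ExteriorAlgebra.ι K (g v) * contract (τ v) w = (j : K) • w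
  | 0, w, hw => by simp [contract_of_mem_zero _ hw]
  | j + 1, w, hw => by
    refine exteriorPower_succ_induction (p := fun w =>
      ∑ v, ExteriorAlgebra.ι K (g v) * contract (τ v) w = ((j + 1 : ℕ) : K) • w)
      (fun x w hw => ?_) (fun w w' h h' => ?_) hw
    · have h1 : ∀ v, ExteriorAlgebra.ι K (g v) * contract (τ v) (ExteriorAlgebra.ι K x * w) =
          ExteriorAlgebra.ι K (τ v x • g v) * w +
            ExteriorAlgebra.ι K x * (ExteriorAlgebra.ι K (g v) * contract (τ v) w) := by
        intro v
        rw [contract_ι_mul, mul_sub, map_smul, smul_mul_assoc, mul_smul_comm, ← mul_assoc,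
          ← mul_assoc, eq_neg_of_add_eq_zero_left (ExteriorAlgebra.ι_add_mul_swap (g v) x),
          neg_mul, sub_neg_eq_add]
      simp only [h1, Finset.sum_add_distrib]
      rw [← Finset.mul_sum, sum_ι_mul_contract h hw, ← Finset.sum_mul, ← map_sum, h]
      push_cast
      rw [add_smul, one_smul, mul_smul_comm, add_comm]
    · simp only [map_add, mul_add, Finset.sum_add_distrib, h, h', smul_add]

theorem sum_contract_ι_mul (h : ∀ x, ∑ v, τ v x • g v = x) {j : ℕ} {w : ExteriorAlgebra K M}
    (hw : w ∈ ⋀[K]^j M) : ∑ v, contract (τ v) (ExteriorAlgebra.ι K (g v) * w) =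
      (∑ v, τ v (g v) - j) • w := by
  simp only [contract_ι_mul, Finset.sum_sub_distrib]
  rw [sum_ι_mul_contract h hw, sub_smul, Finset.sum_smul]

end Exterior

/-! ### The map from the Koszul complex to the linear strand -/

namespace MinimalResolution

variable {n : ℕ} {I : Ideal (CoordRing n)} (P : MinimalResolution I)

/-- The `τ v` are the coordinates of a linear section of the surjection from coefficient vectors
onto `M`. -/
theorem exists_dual_system {M : Type*} [AddCommGroup M] [Module ℂ M] {κ : Type*} [Fintype κ]
    {g : κ → M} (hg : ⊤ ≤ Submodule.span ℂ (Set.range g)) :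
    ∃ τ : κ → Dual ℂ M, ∀ x, ∑ v, τ v x • g v = x := by
  obtain ⟨σ, hσ⟩ := (Fintype.linearCombination ℂ g).exists_rightInverse_of_surjective
    (top_le_iff.1 (by rwa [Fintype.range_linearCombination]))
  refine ⟨fun v => LinearMap.proj v ∘ₗ σ, fun x => ?_⟩
  have := LinearMap.congr_fun hσ x
  rwa [LinearMap.comp_apply, Fintype.linearCombination_apply] at this

variable {q : ℕ} {f : P.Mod (q + 1)}

/-- A map of complexes defined in low exterior degrees only. -/
structure PartialLift (g : Fin (n + 1) → P.involved f) (J : ℕ) where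
  φ : ∀ i, ExteriorAlgebra ℂ (P.involved f) →ₗ[ℂ] P.linSyz i
  φ_one : (φ (q + 1) 1 : P.Mod (q + 1)) = f
  φ_ι : ∀ x : P.involved f, (φ q (ExteriorAlgebra.ι ℂ x) : P.Mod q) = x
  comm : ∀ i j, i + j = q → j < J → ∀ w ∈ ⋀[ℂ]^j (P.involved f),
    P.d i (φ (i + 1) w) =
      ∑ v, (X v : CoordRing n) • (φ i (ExteriorAlgebra.ι ℂ (g v) * w) : P.Mod i)

variable {P} {g : Fin (n + 1) → P.involved f}

theorem exists_partialLift_one (hf : f ∈ P.linSyz (q + 1)) (hle : P.involved f ≤ P.linSyz q)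
    (hg : P.d q f = ∑ v, (X v : CoordRing n) • (g v : P.Mod q)) :
    Nonempty (PartialLift P g 1) := by
  -- Only the components `q + 1` and `q` are prescribed so far; the others are set to zero and
  -- corrected one at a time later.
  let φ : ∀ i, ExteriorAlgebra ℂ (P.involved f) →ₗ[ℂ] P.linSyz i :=
    Function.update (Function.update 0 (q + 1)
      ((ExteriorAlgebra.algebraMapInv (R := ℂ) (M := P.involved f)).toLinearMap.smulRight
        ⟨f, hf⟩)) q ((Submodule.inclusion hle) ∘ₗ ExteriorAlgebra.ιInv)
  have h1 : φ (q + 1) = (ExteriorAlgebra.algebraMapInv (R := ℂ)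
      (M := P.involved f)).toLinearMap.smulRight ⟨f, hf⟩ := by
    simp only [φ]
    rw [Function.update_of_ne (Nat.succ_ne_self q), Function.update_self]
  have h2 : φ q = (Submodule.inclusion hle) ∘ₗ ExteriorAlgebra.ιInv := by
    simp only [φ]
    rw [Function.update_self]
  have h3 : ∀ x : P.involved f, (φ q (ExteriorAlgebra.ι ℂ x) : P.Mod q) = x := fun x => by
    rw [h2, LinearMap.comp_apply, ExteriorAlgebra.ι_leftInverse]
    rfl
  have h4 : (φ (q + 1) 1 : P.Mod (q + 1)) = f := by
    rw [h1]
    simp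
  refine ⟨⟨φ, h4, h3, fun i j hij hj w hw => ?_⟩⟩
  obtain rfl : j = 0 := by omega
  obtain rfl : i = q := by omega
  obtain ⟨c, rfl⟩ := exists_smul_one_of_mem hw
  rw [map_smul, Submodule.coe_smul, h4, LinearMap.map_smul_of_tower, hg, Finset.smul_sum]
  refine Finset.sum_congr rfl fun v _ => ?_
  rw [mul_smul_comm, mul_one, map_smul, Submodule.coe_smul, h3, smul_comm]

variable (hI : ∀ F ∈ I, ∀ m, F.IsHomogeneous m → F ≠ 0 → 2 ≤ m)

-- Applying `d` to a commuting square and using `d² = 0` gives a vanishing quadratic expression in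
-- the variables, whose coefficients are the symmetrized terms.
include hI in
theorem PartialLift.antisymm {J : ℕ} (L : PartialLift P g J) {i j : ℕ} (hij : i + 1 + j = q)
    (hj : j < J) {w : ExteriorAlgebra ℂ (P.involved f)} (hw : w ∈ ⋀[ℂ]^j (P.involved f))
    (u v : Fin (n + 1)) :
    P.diffCoeff i v (L.φ (i + 1) (ExteriorAlgebra.ι ℂ (g u) * w)) =
      - P.diffCoeff i u (L.φ (i + 1) (ExteriorAlgebra.ι ℂ (g v) * w)) := by
  rw [eq_neg_iff_add_eq_zero]
  refine P.add_eq_zero_of_sum_X_smul (w := fun u v =>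
    P.diffCoeff i v (L.φ (i + 1) (ExteriorAlgebra.ι ℂ (g u) * w)))
    (fun u v => P.diffCoeff_mem hI v (Submodule.coe_mem _)) ?_ u v
  have h1 := congrArg (P.d i) (L.comm (i + 1) j hij hj w hw)
  rw [(P.exact_succ i).apply_apply_eq_zero, map_sum] at h1
  rw [h1]
  refine Finset.sum_congr rfl fun u _ => ?_
  rw [map_smul, P.d_eq_sum hI (Submodule.coe_mem _), Finset.smul_sum]
  exact Finset.sum_congr rfl fun v _ => mul_smul _ _ _

-- The new component must send `g_v ∧ w` to `α v w`, the coefficient of `x_v` in `d(φ (i+1) w)`.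
-- Euler's identity leaves only the average `β = (J+2)⁻¹ ∑ α_v ∘ contract(τ_v)`, and antisymmetry of
-- `α_v(g_u ∧ w)` in `u, v` shows that it works.
include hI in
theorem PartialLift.exists_succ {J : ℕ} (hg : ⊤ ≤ Submodule.span ℂ (Set.range g))
    (L : PartialLift P g (J + 1)) : Nonempty (PartialLift P g (J + 2)) := by
  by_cases hJ : q < J + 1
  · exact ⟨⟨L.φ, L.φ_one, L.φ_ι, fun i j hij _ w hw => L.comm i j hij (by omega) w hw⟩⟩
  obtain ⟨τ, hτ⟩ := exists_dual_system hg
  obtain ⟨i, hi⟩ : ∃ i, i + (J + 1) = q := ⟨q - (J + 1), by omega⟩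
  let α : Fin (n + 1) → ExteriorAlgebra ℂ (P.involved f) →ₗ[ℂ] P.linSyz i := fun v =>
    (((P.diffCoeff i v) ∘ₗ (P.linSyz (i + 1)).subtype).codRestrict (P.linSyz i)
      fun w => P.diffCoeff_mem hI v w.2) ∘ₗ L.φ (i + 1)
  have hα : ∀ v w, (α v w : P.Mod i) = P.diffCoeff i v (L.φ (i + 1) w) := fun _ _ => rfl
  have anti : ∀ w ∈ ⋀[ℂ]^J (P.involved f), ∀ u v,
      α v (ExteriorAlgebra.ι ℂ (g u) * w) = - α u (ExteriorAlgebra.ι ℂ (g v) * w) := by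
    intro w hw u v
    apply Subtype.ext
    rw [Submodule.coe_neg, hα, hα]
    exact L.antisymm hI (by omega) (by omega) hw u v
  -- The `g u` may be linearly dependent. On `g_t ∧ w`, antisymmetry turns `α u` into an expression
  -- linear in `g u`, so `α` respects their relations.
  have hsum : ∀ u, ∀ w ∈ ⋀[ℂ]^(J + 1) (P.involved f), ∑ v, τ v (g u) • α v w = α u w := by
    intro u w hw
    refine exteriorPower_succ_induction (K := ℂ) (M := P.involved f)
      (p := fun w => ∑ v, τ v (g u) • α v w = α u w)
      (fun x w hw => ?_) (fun w w' h h' => ?_) hw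
    · have key : ∀ t, ∑ v, τ v (g u) • α v (ExteriorAlgebra.ι ℂ (g t) * w) =
          α u (ExteriorAlgebra.ι ℂ (g t) * w) := by
        intro t
        rw [anti w hw t u]
        conv_rhs => rw [← hτ (g u)]
        simp only [anti w hw t, map_sum, map_smul, Finset.sum_mul, smul_mul_assoc, smul_neg,
          Finset.sum_neg_distrib]
      rw [← hτ x]
      simp only [map_sum, map_smul, Finset.sum_mul, smul_mul_assoc, Finset.smul_sum]
      rw [Finset.sum_comm]
      refine Finset.sum_congr rfl fun t _ => ?_
      rw [← key t, Finset.smul_sum]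
      exact Finset.sum_congr rfl fun v _ => smul_comm _ _ _
    · simp only [map_add, smul_add, Finset.sum_add_distrib, h, h']
  let β : ExteriorAlgebra ℂ (P.involved f) →ₗ[ℂ] P.linSyz i :=
    ((J + 2 : ℕ) : ℂ)⁻¹ • ∑ v, α v ∘ₗ contract (τ v)
  have hβ : ∀ u, ∀ w ∈ ⋀[ℂ]^(J + 1) (P.involved f), β (ExteriorAlgebra.ι ℂ (g u) * w) = α u w := by
    intro u w hw
    have h1 : ∑ v, α v (contract (τ v) (ExteriorAlgebra.ι ℂ (g u) * w)) =
        ((J + 2 : ℕ) : ℂ) • α u w := by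
      have h2 : ∀ v, α v (contract (τ v) (ExteriorAlgebra.ι ℂ (g u) * w)) =
          τ v (g u) • α v w + α u (ExteriorAlgebra.ι ℂ (g v) * contract (τ v) w) := by
        intro v
        rw [contract_ι_mul, map_sub, map_smul, anti _ (contract_mem _ hw) u v, sub_neg_eq_add]
      simp only [h2, Finset.sum_add_distrib]
      rw [hsum u w hw, ← map_sum, sum_ι_mul_contract hτ hw, map_smul]
      push_cast
      module
    simp only [β, LinearMap.smul_apply, LinearMap.sum_apply, LinearMap.comp_apply]
    rw [h1, smul_smul, inv_mul_cancel₀ (Nat.cast_ne_zero.2 (Nat.succ_ne_zero _)), one_smul]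
  have hne : ∀ k, i < k → Function.update L.φ i β k = L.φ k := fun k hk =>
    Function.update_of_ne hk.ne' _ _
  refine ⟨⟨Function.update L.φ i β, ?_, ?_, ?_⟩⟩
  · rw [hne _ (by omega)]; exact L.φ_one
  · rw [hne _ (by omega)]; exact L.φ_ι
  · intro k j hkj hj w hw
    by_cases hk : k = i
    · subst hk
      obtain rfl : j = J + 1 := by omega
      rw [hne _ (by omega), Function.update_self, P.d_eq_sum hI (Submodule.coe_mem _)]
      exact Finset.sum_congr rfl fun v _ => by rw [hβ v w hw, hα]
    · rw [hne _ (by omega), hne _ (by omega)]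
      exact L.comm k j hkj (by omega) w hw

include hI in
/-- The inclusion of the space of involved syzygies extends to a map of complexes. -/
theorem nonempty_koszulLift (hf : f ∈ P.linSyz (q + 1)) : Nonempty (P.KoszulLift f) := by
  have hspan := P.involved_eq hI hf
  let g : Fin (n + 1) → P.involved f := fun v =>
    ⟨P.diffCoeff q v f, hspan.ge (Submodule.subset_span ⟨v, rfl⟩)⟩
  have hle : P.involved f ≤ P.linSyz q := by
    rw [hspan, Submodule.span_le]
    rintro _ ⟨v, rfl⟩
    exact P.diffCoeff_mem hI v hf
  have hg : ⊤ ≤ Submodule.span ℂ (Set.range g) := by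
    rw [← Submodule.map_le_map_iff_of_injective (P.involved f).injective_subtype,
      Submodule.map_top, Submodule.range_subtype, Submodule.map_span, ← Set.range_comp]
    exact hspan.le
  have hdf := P.d_eq_sum hI hf
  have : ∀ J, Nonempty (PartialLift P g (J + 1)) := by
    intro J
    induction J with
    | zero => exact exists_partialLift_one hf hle hdf
    | succ J ih => exact ih.some.exists_succ hI hg
  -- The squares have `j = 0, …, q`, so the bound `q + 1` covers all of them.
  obtain ⟨L⟩ := this q
  exact ⟨⟨g, hdf, fun i => (P.linSyz i).subtype ∘ₗ L.φ i, fun i _ _ w _ => (L.φ i w).2, L.φ_one,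
    L.φ_ι, fun i j hij w hw => L.comm i j hij (by omega) w hw⟩⟩

namespace KoszulLift

include hI in
theorem g_eq (hf : f ∈ P.linSyz (q + 1)) (L : P.KoszulLift f) (v : Fin (n + 1)) :
    (L.g v : P.Mod q) = P.diffCoeff q v f := by
  have hle : P.involved f ≤ P.linSyz q := by
    rw [P.involved_eq hI hf, Submodule.span_le]
    rintro _ ⟨v, rfl⟩
    exact P.diffCoeff_mem hI v hf
  refine sub_eq_zero.1 (P.eq_zero_of_sum_X_smul
    (w := fun v => (L.g v : P.Mod q) - P.diffCoeff q v f)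
    (fun v => Submodule.sub_mem _ (hle (L.g v).2) (P.diffCoeff_mem hI v hf)) ?_ v)
  simp only [smul_sub, Finset.sum_sub_distrib]
  rw [← L.d_f, ← P.d_eq_sum hI hf, sub_self]

include hI in
theorem span_g (hf : f ∈ P.linSyz (q + 1)) (L : P.KoszulLift f) :
    ⊤ ≤ Submodule.span ℂ (Set.range L.g) := by
  have : (P.involved f).subtype ∘ L.g = fun v => P.diffCoeff q v f :=
    funext fun v => L.g_eq hI hf v
  rw [← Submodule.map_le_map_iff_of_injective (P.involved f).injective_subtype,
    Submodule.map_top, Submodule.range_subtype, Submodule.map_span, ← Set.range_comp, this]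
  exact (P.involved_eq hI hf).le

include hI in
/-- The map of complexes is unique. -/
theorem φ_eq (hf : f ∈ P.linSyz (q + 1)) (L L' : P.KoszulLift f) :
    ∀ (j i : ℕ), i + j = q + 1 → ∀ w ∈ ⋀[ℂ]^j (P.involved f), L.φ i w = L'.φ i w := by
  have hg : L.g = L'.g := by
    funext v
    apply Subtype.ext
    rw [L.g_eq hI hf v, L'.g_eq hI hf v]
  obtain ⟨τ, hτ⟩ := exists_dual_system (L.span_g hI hf)
  intro j
  induction j with
  | zero =>
    rintro i hi w hw
    obtain rfl : i = q + 1 := by omega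
    obtain ⟨c, rfl⟩ := exists_smul_one_of_mem hw
    have h1 : ∀ L : P.KoszulLift f, L.φ (q + 1) (c • 1) = c • f := fun L => by
      rw [(L.φ (q + 1)).map_smul c 1, L.φ_one]
    exact (h1 L).trans (h1 L').symm
  | succ j ih =>
    intro i hi w hw
    have key : ∀ w : ExteriorAlgebra ℂ (P.involved f), w ∈ ⋀[ℂ]^j (P.involved f) →
        ∀ v : Fin (n + 1), (L.φ i (ExteriorAlgebra.ι ℂ (L.g v) * w) : P.Mod i) =
          L'.φ i (ExteriorAlgebra.ι ℂ (L.g v) * w) := by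
      intro w hw v
      have h1 := P.eq_zero_of_sum_X_smul (w := fun v =>
        L.φ i (ExteriorAlgebra.ι ℂ (L.g v) * w) - L'.φ i (ExteriorAlgebra.ι ℂ (L.g v) * w))
        (fun v => Submodule.sub_mem _ (L.φ_mem i _ hi _ (ι_mul_mem _ hw))
          (L'.φ_mem i _ hi _ (ι_mul_mem _ hw))) ?_ v
      · exact sub_eq_zero.1 h1
      simp only [smul_sub, Finset.sum_sub_distrib]
      rw [← L.comm i j (by omega) w hw, hg, ← L'.comm i j (by omega) w hw,
        ih (i + 1) (by omega) w hw, sub_self]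
    refine exteriorPower_succ_induction (K := ℂ) (M := P.involved f)
      (p := fun w => L.φ i w = L'.φ i w)
      (fun x w hw => ?_) (fun w w' h h' => ?_) hw
    · rw [← hτ x]
      simp only [map_sum, map_smul, Finset.sum_mul, smul_mul_assoc, key w hw]
    · rw [map_add, map_add, h, h']

include hI in
theorem syzygyIdeal_eq (hf : f ∈ P.linSyz (q + 1)) (L : P.KoszulLift f) :
    P.syzygyIdeal f =
      Ideal.span {F | ∃ w ∈ ⋀[ℂ]^(q + 1) (P.involved f), F = P.ε (L.φ 0 w)} := by
  rw [syzygyIdeal]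
  congr 1
  ext F
  constructor
  · rintro ⟨L', w, hw, rfl⟩
    exact ⟨w, hw, by rw [φ_eq hI hf L' L (q + 1) 0 (by omega) w hw]⟩
  · rintro ⟨w, hw, rfl⟩
    exact ⟨L, w, hw, rfl⟩

/-- If the quadrics vanish, so does the linear syzygy. -/
theorem eq_zero_of_quadrics_eq_zero (L : P.KoszulLift f)
    (h : ∀ w ∈ ⋀[ℂ]^(q + 1) (P.involved f), P.ε (L.φ 0 w) = 0) : f = 0 := by
  -- Induction up the strand: if `φ i` vanishes, then `d ∘ φ (i+1)` does, and `d` is injective on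
  -- linear syzygies. The top component sends `1` to `f`.
  have key : ∀ i j, i + j = q + 1 → ∀ w ∈ ⋀[ℂ]^j (P.involved f), L.φ i w = 0 := by
    intro i
    induction i with
    | zero =>
      intro j hj w hw
      obtain rfl : j = q + 1 := by omega
      exact P.eq_zero_of_ε (L.φ_mem 0 _ hj w hw) (h w hw)
    | succ i ih =>
      intro j hj w hw
      refine P.eq_zero_of_d (L.φ_mem _ _ hj w hw) ?_
      rw [L.comm i j (by omega) w hw]
      exact Finset.sum_eq_zero fun v _ => by
        rw [ih (j + 1) (by omega) _ (ι_mul_mem _ hw), smul_zero]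
  rw [← L.φ_one]
  exact key (q + 1) 0 rfl 1 one_mem_exteriorPower_zero

theorem sum_X_mul_quadric (L : P.KoszulLift f) {w : ExteriorAlgebra ℂ (P.involved f)}
    (hw : w ∈ ⋀[ℂ]^q (P.involved f)) :
    ∑ v, (X v : CoordRing n) * P.ε (L.φ 0 (ExteriorAlgebra.ι ℂ (L.g v) * w)) = 0 := by
  have h := congrArg P.ε (L.comm 0 q (by omega) w hw)
  rw [P.exact_zero.apply_apply_eq_zero, map_sum] at h
  rw [h]
  exact Finset.sum_congr rfl fun v _ => by rw [map_smul, smul_eq_mul]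

end KoszulLift

end MinimalResolution

/-! ### Koszul cocycles of degree two -/

section Koszul

theorem mem_span_X_pair_of_X_mul_mem {σ : Type*} {i j k : σ} (hik : k ≠ i) (hjk : k ≠ j)
    {F : MvPolynomial σ ℂ} (h : X k * F ∈ Ideal.span {X i, X j}) :
    F ∈ Ideal.span {X i, X j} := by
  have himg : ({X i, X j} : Set (MvPolynomial σ ℂ)) = X '' {i, j} := (Set.image_pair _ _ _).symm
  rw [himg, mem_ideal_span_X_image] at h ⊢
  intro m hm
  obtain ⟨l, hl, hl'⟩ := h (Finsupp.single k 1 + m) (by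
    rw [MvPolynomial.mem_support_iff, coeff_X_mul]
    exact MvPolynomial.mem_support_iff.1 hm)
  refine ⟨l, hl, ?_⟩
  have hkl : k ≠ l := by
    rcases hl with rfl | rfl
    · exact hik
    · exact hjk
  rwa [Finsupp.add_apply, Finsupp.single_eq_of_ne' hkl, zero_add] at hl'

/-- Cocycles of degree two of a Koszul complex on at least three variables are coboundaries. -/
theorem exists_of_koszul_cocycle {σ κ : Type*} {s : κ → σ} (hs : Function.Injective s)
    {Q : κ → κ → MvPolynomial σ ℂ} (hQ : ∀ i, Q i i = 0)
    (hc : ∀ i j k, X (s i) * Q j k - X (s j) * Q i k + X (s k) * Q i j = 0)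
    (o : κ) (ho : ∀ j, ∃ k, k ≠ o ∧ k ≠ j) :
    ∃ m : κ → MvPolynomial σ ℂ, ∀ i j, Q i j = X (s i) * m j - X (s j) * m i := by
  -- A third variable `x_k` is a nonzerodivisor modulo `(x_o, x_j)`, so the cocycle relation puts `Q
  -- o j` into this ideal. The coefficient `c` may still depend on `j`.
  have h1 : ∀ j, ∃ m c : MvPolynomial σ ℂ, j ≠ o → Q o j = X (s o) * m - X (s j) * c := by
    intro j
    obtain ⟨k, hko, hkj⟩ := ho j
    have h2 : X (s k) * Q o j ∈ Ideal.span {X (s o), X (s j)} := by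
      rw [Ideal.mem_span_pair]
      exact ⟨-Q j k, Q o k, by linear_combination -hc o j k⟩
    obtain ⟨x, y, hxy⟩ := Ideal.mem_span_pair.1
      (mem_span_X_pair_of_X_mul_mem (hs.ne hko) (hs.ne hkj) h2)
    exact ⟨x, -y, fun _ => by rw [← hxy]; ring⟩
  choose m c hmc using h1
  -- The cocycle relation for `o, j, k` shows that the `c j` agree modulo `x_o`; the differences can
  -- then be absorbed into the `m j`, leaving a common `c p`.
  have hdvd : ∀ j k, j ≠ o → k ≠ o → X (s o) ∣ c k - c j := by
    intro j k hj hk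
    by_cases hjk : j = k
    · simp [hjk]
    have h2 : X (s o) ∣ X (s j) * (X (s k) * (c k - c j)) := by
      refine ⟨X (s j) * m k - X (s k) * m j - Q j k, ?_⟩
      have h3 := hc o j k
      rw [hmc j hj, hmc k hk] at h3
      linear_combination h3
    refine (X_prime.dvd_or_dvd ((X_prime.dvd_or_dvd h2).resolve_left ?_)).resolve_left ?_
    · rw [X_dvd_X]; exact hs.ne (Ne.symm hj)
    · rw [X_dvd_X]; exact hs.ne (Ne.symm hk)
  obtain ⟨p, hp, -⟩ := ho o
  have h4 : ∀ j, ∃ e, j ≠ o → c j = c p + X (s o) * e := by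
    intro j
    by_cases hj : j = o
    · exact ⟨0, fun h => absurd hj h⟩
    · obtain ⟨e, he⟩ := hdvd p j hp hj
      exact ⟨e, fun _ => by rw [← he]; ring⟩
  choose e he using h4
  classical
  let m' : κ → MvPolynomial σ ℂ := fun j => if j = o then c p else m j - X (s j) * e j
  have h5 : ∀ j, Q o j = X (s o) * m' j - X (s j) * m' o := by
    intro j
    by_cases hj : j = o
    · subst hj
      rw [hQ, sub_self]
    · simp only [m', if_neg hj, if_true]
      rw [hmc j hj, he j hj]
      ring
  refine ⟨m', fun i j => ?_⟩
  refine mul_left_cancel₀ (X_ne_zero (s o)) ?_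
  have h6 := hc o i j
  rw [h5 i, h5 j] at h6
  linear_combination h6

theorem homogeneousComponent_linForm_mul {n : ℕ} (c : Fin (n + 1) → ℂ) (F : CoordRing n) :
    homogeneousComponent 2 (linForm c * F) = linForm c * homogeneousComponent 1 F := by
  have h1 : ∀ i, homogeneousComponent 2 (linForm c * homogeneousComponent i F) =
      if i = 1 then linForm c * homogeneousComponent i F else 0 := by
    intro i
    rw [homogeneousComponent_of_mem (n := 1 + i)
      ((isHomogeneous_linForm c).mul (homogeneousComponent_isHomogeneous i F))]
    exact if_congr (by omega) rfl rfl
  conv_lhs => rw [← sum_homogeneousComponent F, Finset.mul_sum, map_sum]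
  simp only [h1, Finset.sum_ite_eq', Finset.mem_range]
  split_ifs with h
  · rfl
  · rw [homogeneousComponent_eq_zero _ _ (by omega), mul_zero]

/-- A Koszul cocycle consisting of quadrics is given by the minors of a pencil. -/
theorem exists_pencil_of_cocycle {n : ℕ} {U : Type*} [AddCommGroup U] [Module ℂ U]
    [FiniteDimensional ℂ U] (hU : 3 ≤ finrank ℂ U) {A : U →ₗ[ℂ] (Fin (n + 1) → ℂ)}
    (hA : Function.Injective A) {Q : U →ₗ[ℂ] U →ₗ[ℂ] CoordRing n} (hQ : ∀ u, Q u u = 0)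
    (hhom : ∀ u u', (Q u u').IsHomogeneous 2)
    (hc : ∀ x y z, linForm (A x) * Q y z - linForm (A y) * Q x z + linForm (A z) * Q x y = 0) :
    ∃ B : U →ₗ[ℂ] (Fin (n + 1) → ℂ), ∀ u u',
      Q u u' = linForm (A u) * linForm (B u') - linForm (A u') * linForm (B u) := by
  let b := finBasis ℂ U
  have hli : LinearIndependent ℂ (A ∘ b) := b.linearIndependent.map' A (LinearMap.ker_eq_bot.2 hA)
  -- Completing the independent forms `A (b k)` to a coordinate system turns them into variables.
  let e := Basis.sumExtend hli
  have : Finite (Fin (finrank ℂ U) ⊕ Basis.sumExtendIndex hli) := Module.Finite.finite_basis e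
  have := Fintype.ofFinite (Fin (finrank ℂ U) ⊕ Basis.sumExtendIndex hli)
  have he : ∀ k, e (Sum.inl k) = A (b k) := fun k => by
    simp only [e, Basis.sumExtend, Basis.reindex_apply, Basis.extend_apply_self]
    rfl
  have hX : ∀ k, (coordEquiv e).symm (linForm (A (b k))) = X (Sum.inl k) := fun k => by
    rw [← he, ← coordEquiv_X, AlgEquiv.symm_apply_apply]
  obtain ⟨m, hm⟩ := exists_of_koszul_cocycle (s := Sum.inl) Sum.inl_injective
    (Q := fun i j => (coordEquiv e).symm (Q (b i) (b j))) (fun i => by rw [hQ, map_zero])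
    (fun i j k => by rw [← hX, ← hX, ← hX, ← map_mul, ← map_mul, ← map_mul, ← map_sub, ← map_add,
      hc, map_zero])
    ⟨0, by omega⟩ (fun j => by
      by_cases hj : j = ⟨1, by omega⟩
      · refine ⟨⟨2, by omega⟩, ?_, ?_⟩ <;> simp [hj]
      · exact ⟨⟨1, by omega⟩, by simp, Ne.symm hj⟩)
  -- The cochain `m` need not be homogeneous; as `Q` is quadratic, the linear parts suffice.
  choose c hcc using fun k => exists_linForm_eq
    (homogeneousComponent_isHomogeneous 1 (coordEquiv e (m k)))
  let B : U →ₗ[ℂ] (Fin (n + 1) → ℂ) := b.constr ℂ c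
  have hB : ∀ k, B (b k) = c k := fun k => b.constr_basis ℂ c k
  have key : ∀ i j, Q (b i) (b j) =
      linForm (A (b i)) * linForm (B (b j)) - linForm (A (b j)) * linForm (B (b i)) := by
    intro i j
    have h1 : Q (b i) (b j) = linForm (A (b i)) * coordEquiv e (m j) -
        linForm (A (b j)) * coordEquiv e (m i) := by
      have := congrArg (coordEquiv e) (hm i j)
      rwa [AlgEquiv.apply_symm_apply, map_sub, map_mul, map_mul, coordEquiv_X, coordEquiv_X, he,
        he] at this
    have h2 := congrArg (homogeneousComponent 2) h1
    rwa [homogeneousComponent_of_mem (hhom _ _), if_pos rfl, map_sub,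
      homogeneousComponent_linForm_mul, homogeneousComponent_linForm_mul, ← hcc, ← hcc, ← hB,
      ← hB] at h2
  refine ⟨B, ?_⟩
  let M : U →ₗ[ℂ] U →ₗ[ℂ] CoordRing n :=
    (LinearMap.mul ℂ (CoordRing n)).compl₁₂ (linForm ∘ₗ A) (linForm ∘ₗ B)
  have hQM : Q = M - M.flip := LinearMap.ext_basis b b fun i j => by
    rw [key]
    simp [M]
  intro u u'
  rw [hQM]
  simp [M]

end Koszul

/-! ### The ideal of the quadrics of a Koszul lift -/

section Hodge

variable {K M : Type*} [Field K] [AddCommGroup M] [Module K M] [FiniteDimensional K M]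

theorem exists_volume {N : ℕ} (hN : finrank K M = N) :
    ∃ Ω ∈ ⋀[K]^N M, (∀ w ∈ ⋀[K]^N M, ∃ c : K, w = c • Ω) ∧
      ∀ x : M, ExteriorAlgebra.ι K x * Ω = 0 := by
  have h1 : finrank K (⋀[K]^N M) = 1 := by
    rw [exteriorPower.finrank_eq, hN, Nat.choose_self]
  have h2 : finrank K (⋀[K]^(N + 1) M) = 0 := by
    rw [exteriorPower.finrank_eq, hN, Nat.choose_eq_zero_of_lt (Nat.lt_succ_self N)]
  obtain ⟨Ω, -, hΩ⟩ := finrank_eq_one_iff'.1 h1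
  refine ⟨Ω, Ω.2, fun w hw => ?_, fun x => ?_⟩
  · obtain ⟨c, hc⟩ := hΩ ⟨w, hw⟩
    exact ⟨c, (congrArg Subtype.val hc).symm⟩
  · have h3 := ι_mul_mem x Ω.2
    rwa [Submodule.finrank_eq_zero.1 h2, Submodule.mem_bot] at h3

/-- `sum_contract_ι_mul` expresses `(N - j) w` as a sum of contractions of elements of degree `j +
1`, and `N - j` is invertible. -/
theorem mem_of_contract_mem [CharZero K] {N j : ℕ} (hN : finrank K M = N) (hj : j < N)
    {S : Submodule K (ExteriorAlgebra K M)}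
    (hS : ∀ w ∈ ⋀[K]^(j + 1) M, ∀ l, contract l w ∈ S) {w : ExteriorAlgebra K M}
    (hw : w ∈ ⋀[K]^j M) : w ∈ S := by
  let b := finBasis K M
  have h1 := sum_contract_ι_mul (g := b) (τ := b.coord) (fun x => b.sum_repr x) hw
  have h2 : ∑ v, b.coord v (b v) = (N : K) := by simp [hN]
  have h3 : ((N : K) - j) ≠ 0 := sub_ne_zero.2 (by exact_mod_cast hj.ne')
  rw [h2] at h1
  rw [← inv_smul_smul₀ h3 w, ← h1]
  exact S.smul_mem _ (S.sum_mem fun v _ => hS _ (ι_mul_mem _ hw) _)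

/-- Elements of corank two are combinations of double contractions of the volume element. -/
theorem mem_of_contract_contract_mem [CharZero K] {N : ℕ} (hN : finrank K M = N + 2)
    {Ω : ExteriorAlgebra K M} (hΩ : ∀ w ∈ ⋀[K]^(N + 2) M, ∃ c : K, w = c • Ω)
    {S : Submodule K (ExteriorAlgebra K M)}
    (hS : ∀ l l', contract l (contract l' Ω) ∈ S) {w : ExteriorAlgebra K M}
    (hw : w ∈ ⋀[K]^N M) : w ∈ S := by
  refine mem_of_contract_mem hN (by omega) (fun w hw l => ?_) hw
  have h1 : w ∈ S.comap (contract l) := by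
    refine mem_of_contract_mem hN (Nat.lt_succ_self _) (fun w hw l' => ?_) hw
    obtain ⟨c, rfl⟩ := hΩ w hw
    rw [Submodule.mem_comap, LinearMap.map_smul, LinearMap.map_smul]
    exact S.smul_mem c (hS l l')
  exact Submodule.mem_comap.1 h1

end Hodge

/-! ### The pencil attached to a syzygy of rank `p + 2` -/

namespace MinimalResolution

variable {n : ℕ} {X : Set (ProjSpace n)}

/-- The syzygy ideal of a linear syzygy of rank `q + 3` is the ideal of minors of a pencil of
injective maps. -/
theorem exists_pencil (hX : IsIrreducibleVariety X) (hnd : IsNondegenerate X)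
    (P : MinimalResolution (vanishingIdeal X)) {q : ℕ} {f : P.Mod (q + 1)}
    (hf : f ∈ P.linSyz (q + 1)) (hrank : P.rank f = q + 3) :
    ∃ A B : Dual ℂ (P.involved f) →ₗ[ℂ] (Fin (n + 1) → ℂ), IsInjectivePencil A B ∧
      P.syzygyIdeal f = pencilIdeal A B := by
  have hI : ∀ F ∈ vanishingIdeal X, ∀ m, F.IsHomogeneous m → F ≠ 0 → 2 ≤ m :=
    fun F hF m hm h0 => two_le_of_mem_vanishingIdeal hX.nonempty hnd hF hm h0
  have hrank' : finrank ℂ (P.involved f) = q + 3 := hrank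
  have : FiniteDimensional ℂ (P.involved f) := FiniteDimensional.of_finrank_pos (by omega)
  obtain ⟨L⟩ := nonempty_koszulLift hI hf
  obtain ⟨Ω, hΩ, hΩ', hΩ0⟩ := exists_volume hrank'
  let Q₀ : ExteriorAlgebra ℂ (P.involved f) →ₗ[ℂ] CoordRing n := P.ε.restrictScalars ℂ ∘ₗ L.φ 0
  have hQ₀ : ∀ w, Q₀ w = P.ε (L.φ 0 w) := fun _ => rfl
  let A : Dual ℂ (P.involved f) →ₗ[ℂ] (Fin (n + 1) → ℂ) :=
    LinearMap.pi fun v => Dual.eval ℂ (P.involved f) (L.g v)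
  have hA : ∀ l v, A l v = l (L.g v) := fun _ _ => rfl
  have hAinj : Function.Injective A := by
    rw [injective_iff_map_eq_zero]
    intro l hl
    refine LinearMap.ext_on (top_le_iff.1 (L.span_g hI hf)) ?_
    rintro _ ⟨v, rfl⟩
    rw [← hA, hl]
    rfl
  let Q : Dual ℂ (P.involved f) →ₗ[ℂ] Dual ℂ (P.involved f) →ₗ[ℂ] CoordRing n :=
    LinearMap.mk₂ ℂ (fun l l' => Q₀ (contract l (contract l' Ω)))
      (fun l l' l'' => by rw [contract_add, map_add])
      (fun c l l' => by rw [contract_smul, map_smul])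
      (fun l l' l'' => by rw [contract_add, map_add, map_add])
      (fun c l l' => by rw [contract_smul, map_smul, map_smul])
  have hQ : ∀ l l', Q l l' = Q₀ (contract l (contract l' Ω)) := fun _ _ => rfl
  have hmem : ∀ l l', contract l (contract l' Ω) ∈ ⋀[ℂ]^(q + 1) (P.involved f) :=
    fun l l' => contract_mem l (contract_mem l' hΩ)
  have hcoc : ∀ x y z, linForm (A x) * Q y z - linForm (A y) * Q x z +
      linForm (A z) * Q x y = 0 := by
    intro x y z
    -- Moving `g_v` through the three contractions leaves these terms, because `g_v ∧ Ω = 0`.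
    have h1 : ∀ v, ExteriorAlgebra.ι ℂ (L.g v) * contract x (contract y (contract z Ω)) =
        x (L.g v) • contract y (contract z Ω) - y (L.g v) • contract x (contract z Ω) +
          z (L.g v) • contract x (contract y Ω) := by
      intro v
      have h2 : ExteriorAlgebra.ι ℂ (L.g v) * contract z Ω = z (L.g v) • Ω := by
        have := contract_ι_mul z (L.g v) Ω
        rw [hΩ0, map_zero] at this
        exact (sub_eq_zero.1 this.symm).symm
      have h3 : ExteriorAlgebra.ι ℂ (L.g v) * contract y (contract z Ω) =
          y (L.g v) • contract z Ω - z (L.g v) • contract y Ω := by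
        have := contract_ι_mul y (L.g v) (contract z Ω)
        rw [h2, map_smul] at this
        rw [this, sub_sub_cancel]
      have h4 := contract_ι_mul x (L.g v) (contract y (contract z Ω))
      rw [h3, map_sub, map_smul, map_smul] at h4
      rw [← sub_sub_cancel (x (L.g v) • contract y (contract z Ω))
        (ExteriorAlgebra.ι ℂ (L.g v) * contract x (contract y (contract z Ω))), ← h4]
      abel
    have h5 : ∑ v, (MvPolynomial.X v : CoordRing n) *
        Q₀ (ExteriorAlgebra.ι ℂ (L.g v) * contract x (contract y (contract z Ω))) = 0 :=
      L.sum_X_mul_quadric (contract_mem x (contract_mem y (contract_mem z hΩ)))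
    rw [← h5, linForm_apply, linForm_apply, linForm_apply, Finset.sum_mul, Finset.sum_mul,
      Finset.sum_mul, ← Finset.sum_sub_distrib, ← Finset.sum_add_distrib]
    refine Finset.sum_congr rfl fun v _ => ?_
    rw [h1, Q₀.map_add, Q₀.map_sub, Q₀.map_smul, Q₀.map_smul, Q₀.map_smul, ← hQ, ← hQ, ← hQ,
      hA, hA, hA]
    simp only [smul_eq_C_mul]
    ring
  obtain ⟨B, hB⟩ := exists_pencil_of_cocycle (by rw [Subspace.dual_finrank_eq]; omega) hAinj
    (fun l => by rw [hQ, contract_contract, map_zero])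
    (fun l l' => P.isHomogeneous_ε (L.φ_mem 0 (q + 1) (by omega) _ (hmem l l'))) hcoc
  refine ⟨A, B, fun s t hst l hl => ?_, ?_⟩
  · by_contra hl0
    have hAl : A l ≠ 0 := fun h => hl0 (hAinj (h.trans (map_zero A).symm))
    have ht : t ≠ 0 := by
      rintro rfl
      rw [zero_smul, add_zero, smul_eq_zero] at hl
      exact hl.elim (by simpa using hst) hAl
    have hBl : B l = (-(t⁻¹ * s)) • A l := by
      rw [neg_smul, mul_smul, ← smul_neg, eq_inv_smul_iff₀ ht, eq_neg_iff_add_eq_zero]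
      exact (add_comm _ _).trans hl
    -- `Q l l'` now factors as `A l` times a linear form. It lies in the ideal of the irreducible
    -- variety `X`, which contains no nonzero linear form.
    have hBμ : ∀ l', B l' = (-(t⁻¹ * s)) • A l' := by
      intro l'
      have h1 : linForm (A l) * linForm (B l' - (-(t⁻¹ * s)) • A l') ∈ vanishingIdeal X := by
        have h2 : linForm (A l) * linForm (B l' - (-(t⁻¹ * s)) • A l') = Q l l' := by
          rw [hB, hBl]
          simp only [map_sub, map_smul, smul_eq_C_mul]
          ring
        rw [h2]
        exact P.ε_mem _
      rcases hX.linForm_mem_or_mem h1 with h | h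
      · exact absurd (hnd.eq_zero_of_linForm_mem h) hAl
      · exact sub_eq_zero.1 (hnd.eq_zero_of_linForm_mem h)
    -- With `B` proportional to `A` all minors vanish. The double contractions of `Ω` span `⋀^(q+1)
    -- G`, so all quadrics vanish, hence `f = 0` and its rank is zero.
    have hzero : ∀ w ∈ ⋀[ℂ]^(q + 1) (P.involved f), P.ε (L.φ 0 w) = 0 := by
      intro w hw
      refine LinearMap.mem_ker.1 (mem_of_contract_contract_mem (S := LinearMap.ker Q₀) hrank' hΩ'
        (fun l l' => ?_) hw)
      rw [LinearMap.mem_ker, ← hQ, hB, hBμ, hBμ]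
      simp only [map_smul, smul_eq_C_mul]
      ring
    have hf0 := L.eq_zero_of_quadrics_eq_zero hzero
    have hbot : P.involved f = ⊥ := by
      rw [P.involved_eq hI hf, Submodule.span_eq_bot]
      rintro _ ⟨v, rfl⟩
      change P.diffCoeff q v f = 0
      rw [hf0, map_zero]
    rw [hbot, finrank_bot] at hrank'
    omega
  · rw [L.syzygyIdeal_eq hI hf]
    apply le_antisymm
    · rw [Ideal.span_le]
      rintro _ ⟨w, hw, rfl⟩
      refine mem_of_contract_contract_mem (S := ((pencilIdeal A B).restrictScalars ℂ).comap Q₀)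
        hrank' hΩ' (fun l l' => ?_) hw
      rw [Submodule.mem_comap, ← hQ, hB]
      exact minor_mem_pencilIdeal A B l l'
    · rw [pencilIdeal, Ideal.span_le]
      rintro _ ⟨l, l', rfl⟩
      rw [← hB]
      exact Ideal.subset_span ⟨_, hmem l l', rfl⟩

end MinimalResolution

end SyzScheme

/-- Since the space of `(p - 1)`-st syzygies involved in `f` occurs, `p ≥ 1`; it is written as
`p = q + 1`. The codimension of the syzygy scheme is the height of its homogeneous ideal. -/
theorem corollary5p2 (n p q : ℕ) (hp : p = q + 1)
    (X : Set (SyzScheme.ProjSpace n))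
    (hX : SyzScheme.IsIrreducibleVariety X)
    (hnd : SyzScheme.IsNondegenerate X)
    (hquad : SyzScheme.GeneratedByQuadrics (SyzScheme.vanishingIdeal X))
    (P : SyzScheme.MinimalResolution (SyzScheme.vanishingIdeal X))
    (f : P.Mod (q + 1)) (hf : f ∈ P.linSyz (q + 1))
    (hrank : P.rank f = p + 2) :
    SyzScheme.DefinesRationalNormalScroll (P.syzygyIdeal f) ∧
      SyzScheme.HasDegree (P.syzygyIdeal f) (p + 2) ∧
      (P.syzygyIdeal f).height = ((p + 1 : ℕ) : ℕ∞) := by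
  subst hp
  obtain ⟨A, B, h, heq⟩ := SyzScheme.MinimalResolution.exists_pencil hX hnd P hf hrank
  have hrank' : Module.finrank ℂ (P.involved f) = q + 1 + 2 := hrank
  have : FiniteDimensional ℂ (P.involved f) := FiniteDimensional.of_finrank_pos (by omega)
  -- The columns of the matrix are indexed by the dual of `G`: its dimension `p + 2` is the degree,
  -- and one less is the height.
  have hdual : Module.finrank ℂ (Module.Dual ℂ (P.involved f)) = q + 1 + 2 := by
    rw [Subspace.dual_finrank_eq, hrank']
  have : Nontrivial (Module.Dual ℂ (P.involved f)) :=
    Module.nontrivial_of_finrank_pos (R := ℂ) (by omega)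
  rw [heq]
  refine ⟨SyzScheme.definesRationalNormalScroll_pencilIdeal h, ?_,
    SyzScheme.height_pencilIdeal h hdual⟩
  rw [← hdual]
  exact SyzScheme.hasDegree_pencilIdeal h
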